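/- Let $\Omega\subset\mathbb{R}^N$ ($N\ge 1$) be a bounded open set with Lipschitz boundary, $\partial\Omega=\Gamma_D\cup\Gamma_N$ with $\Gamma_D\cap\Gamma_N=\emptyset$. Let $m>0$, $f\in L^2(\Omega)$, and let $\xi_1,\xi_2\in L^1(\Omega)$ satisfy $0<\xi_1\le\xi_2$ a.e. in $\Omega$ and $\xi_1^{-1}\in L^1(\Omega)$. *Notation.* $C_0^\infty(\mathbb{R}^N;\Gamma_D)$ is the set of $\varphi\in C_0^\infty(\mathbb{R}^N)$ with $\varphi=0$ on $\Gamma_D$, and $W^{1,1}(\Omega;\Gamma_D)$ is its closure in $W^{1,1}(\Omega)$. A weight on $\Omega$ is a function $\rho>0$ a.e. in $\Omega$ with $\rho,\rho^{-1}\in L^1(\Omega)$; for a weight $\rho$, $W_\rho$ is the set of $y\in W^{1,1}(\Omega;\Gamma_D)$ with $\int_\Omega (y^2+\rho|\nabla y|^2)\,dx<\infty$. $\mathcal{R}_{ad}$ is the set of weights $\rho\in BV(\Omega)$ with $\int_\Omega\rho\,dx=m$ and $\xi_1\le\rho\le\xi_2$ a.e. in $\Omega$. $\Xi_W$ is the set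 of pairs $(\rho,y)$ with $\rho\in\mathcal{R}_{ad}$, $y\in W_\rho$ and $$\int_\Omega(\rho\nabla y\cdot\nabla\varphi+y\varphi)\,dx=\int_\Omega f\varphi\,dx\qquad\text{for all }\varphi\in C_0^\infty(\mathbb{R}^N;\Gamma_D).$$ A sequence $(\rho_k,y_k)\in\Xi_W$ is bounded if $\sup_k\big[\|\rho_k\|_{BV(\Omega)}+\|y_k\|_{L^2(\Omega)}+\|\nabla y_k\|_{L^2(\Omega,\rho_k dx)^N}\big]<\infty$. A bounded sequence $(\rho_k,y_k)\in\Xi_W$ $\tau$-converges to $(\rho,y)\in BV(\Omega)\times W^{1,1}(\Omega)$ if (a) $\rho_k\to\rho$ in $L^1(\Omega)$ and $D\rho_k\rightharpoonup D\rho$ weakly* as $\mathbb{R}^N$-valued measures on $\Omega$ (tested against $C_0(\Omega)$); (b) $y_k\rightharpoonup y$ weakly in $L^2(\Omega)$; (c) $\nabla y\in L^2(\Omega,\rho\,dx)^N$ and $\nabla y_k\rightharpoonup\nabla y$ in the variable space $L^2(\Omega,\rho_k dx)^N$, i.e. $\limsup_k\int_\Omega|\nabla y_k|^2\rho_k\,dx<\infty$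 and $\int_\Omega\varphi\,\nabla y_k\,\rho_k\,dx\to\int_\Omega\varphi\,\nabla y\,\rho\,dx$ for all $\varphi\in C_0^\infty(\Omega)$. **Lemma.** Let $\{(\rho_k,y_k)\}_{k\in\mathbb{N}}\subset\Xi_W$ be a bounded sequence. Then there is a pair $(\rho,y)\in BV(\Omega)\times W^{1,1}(\Omega)$ such that a subsequence of $\{(\rho_k,y_k)\}$ $\tau$-converges to $(\rho,y)$; moreover $\rho$ is a weight on $\Omega$ and $y\in W_\rho$. -/

import Mathlib

open MeasureTheory Filter Topology TopologicalSpace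
open scoped ENNReal NNReal Distributions ZeroAtInfty

noncomputable section

namespace WeightedControl

/-- The Euclidean space `ℝ^N`. -/
abbrev Eu (N : ℕ) : Type := EuclideanSpace ℝ (Fin N)

/-- The `i`-th vector of the standard basis of `ℝ^N`. -/
abbrev stdVec {N : ℕ} (i : Fin N) : Eu N := EuclideanSpace.single i (1 : ℝ)

/-- Lebesgue measure on `Ω`. -/
abbrev vol {N : ℕ} (Ω : Opens (Eu N)) : Measure (Eu N) :=
  (volume : Measure (Eu N)).restrict (Ω : Set (Eu N))

/-- The boundary of `Ω` is Lipschitz: near each boundary point, and for a suitable unit vector `ν`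
(the local vertical axis), `Ω` is the set of points strictly above the graph of a Lipschitz
function `g` of the component orthogonal to `ν`. -/
def HasLipschitzBoundary {N : ℕ} (Ω : Opens (Eu N)) : Prop :=
  ∀ x₀ ∈ frontier (Ω : Set (Eu N)), ∃ (ν : Eu N) (r : ℝ) (K : ℝ≥0) (g : Eu N → ℝ),
    ‖ν‖ = 1 ∧ 0 < r ∧ LipschitzWith K g ∧
      ∀ x ∈ Metric.ball x₀ r, (x ∈ Ω ↔ g (x - inner ℝ x ν • ν) < inner ℝ x ν)

/-- `G` is an integrable weak gradient of `y` in `Ω`. -/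
def IsWeakGradient {N : ℕ} (Ω : Opens (Eu N)) (y : Eu N → ℝ) (G : Eu N → Eu N) : Prop :=
  Integrable G (vol Ω) ∧
    ∀ (φ : 𝓓(Ω, ℝ)) (i : Fin N),
      ∫ x, y x * fderiv ℝ φ x (stdVec i) ∂(vol Ω) = -∫ x, G x i * φ x ∂(vol Ω)

/-- `y ∈ W^{1,1}(Ω)`. -/
def MemW11 {N : ℕ} (Ω : Opens (Eu N)) (y : Eu N → ℝ) : Prop :=
  Integrable y (vol Ω) ∧ ∃ G : Eu N → Eu N, IsWeakGradient Ω y G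

open Classical in
/-- The weak gradient `∇y` of `y ∈ W^{1,1}(Ω)` (unique almost everywhere in `Ω`). -/
def weakGradient {N : ℕ} (Ω : Opens (Eu N)) (y : Eu N → ℝ) : Eu N → Eu N :=
  if h : ∃ G : Eu N → Eu N, IsWeakGradient Ω y G then h.choose else 0

/-- `φ ∈ C_0^∞(ℝ^N; Γ_D)`: smooth, compactly supported in `ℝ^N`, and zero on `Γ_D`. -/
def VanishesOn {N : ℕ} (ΓD : Set (Eu N)) (φ : 𝓓((⊤ : Opens (Eu N)), ℝ)) : Prop :=
  ∀ x ∈ ΓD, φ x = 0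

/-- `y ∈ W^{1,1}(Ω; Γ_D)`: the closure of `C_0^∞(ℝ^N; Γ_D)` in `W^{1,1}(Ω)`. -/
def MemW11D {N : ℕ} (Ω : Opens (Eu N)) (ΓD : Set (Eu N)) (y : Eu N → ℝ) : Prop :=
  MemW11 Ω y ∧
    ∀ ε : ℝ≥0∞, 0 < ε → ∃ φ : 𝓓((⊤ : Opens (Eu N)), ℝ), VanishesOn ΓD φ ∧
      eLpNorm (fun x => y x - φ x) 1 (vol Ω)
        + eLpNorm (fun x => weakGradient Ω y x - gradient φ x) 1 (vol Ω) < ε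

/-- `ρ` is a weight on `Ω`. Only the values of `ρ` in `Ω` matter. -/
def IsWeight {N : ℕ} (Ω : Opens (Eu N)) (ρ : Eu N → ℝ) : Prop :=
  (∀ᵐ x ∂(vol Ω), 0 < ρ x) ∧ Integrable ρ (vol Ω) ∧ Integrable (fun x => (ρ x)⁻¹) (vol Ω)

/-- The measure `ρ dx` on `Ω`. -/
def weightedMeasure {N : ℕ} (Ω : Opens (Eu N)) (ρ : Eu N → ℝ) : Measure (Eu N) :=
  (vol Ω).withDensity fun x => ENNReal.ofReal (ρ x)

/-- `y ∈ W_ρ`: `y ∈ W^{1,1}(Ω; Γ_D)` and `∫_Ω (y² + ρ |∇y|²) dx < ∞`. -/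
def MemWρ {N : ℕ} (Ω : Opens (Eu N)) (ΓD : Set (Eu N)) (ρ y : Eu N → ℝ) : Prop :=
  MemW11D Ω ΓD y ∧ MemLp y 2 (vol Ω) ∧ MemLp (weakGradient Ω y) 2 (weightedMeasure Ω ρ)

/-- The divergence of a vector field. -/
def divergence {N : ℕ} (φ : Eu N → Eu N) (x : Eu N) : ℝ :=
  ∑ i : Fin N, fderiv ℝ φ x (stdVec i) i

/-- The total variation `∫_Ω |Df|`. -/
def totalVariation {N : ℕ} (Ω : Opens (Eu N)) (f : Eu N → ℝ) : ℝ≥0∞ :=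
  ⨆ (φ : 𝓓^{1}(Ω, Eu N)) (_ : ∀ x, ‖φ x‖ ≤ 1),
    ENNReal.ofReal (∫ x, f x * divergence φ x ∂(vol Ω))

/-- `f ∈ BV(Ω)`. -/
def MemBV {N : ℕ} (Ω : Opens (Eu N)) (f : Eu N → ℝ) : Prop :=
  Integrable f (vol Ω) ∧ totalVariation Ω f < ⊤

/-- The norm of `BV(Ω)`. -/
def bvNorm {N : ℕ} (Ω : Opens (Eu N)) (f : Eu N → ℝ) : ℝ≥0∞ :=
  eLpNorm f 1 (vol Ω) + totalVariation Ω f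

/-- The integral of `φ` against a signed measure. -/
def signedIntegral {X : Type*} [MeasurableSpace X] (μ : SignedMeasure X) (φ : X → ℝ) : ℝ :=
  (∫ x, φ x ∂μ.toJordanDecomposition.posPart) - ∫ x, φ x ∂μ.toJordanDecomposition.negPart

/-- The distributional gradient `Df` on `Ω` is the `ℝ^N`-valued Borel measure `(μ_1, …, μ_N)`. -/
def IsDistribGradient {N : ℕ} (Ω : Opens (Eu N)) (f : Eu N → ℝ) (μ : Fin N → SignedMeasure Ω) :
    Prop :=
  ∀ (φ : 𝓓(Ω, ℝ)) (i : Fin N),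
    ∫ x, f x * fderiv ℝ φ x (stdVec i) ∂(vol Ω) = -signedIntegral (μ i) fun x : Ω => φ x

/-- `f_k ⇀ f` weakly in `BV(Ω)`: all functions are in `BV(Ω)`, `f_k → f` in `L¹(Ω)`, and
`Df_k ⇀ Df` weakly* in `M(Ω; ℝ^N)`, i.e. against functions of `C_0(Ω)`. -/
def BVWeakConv {N : ℕ} (Ω : Opens (Eu N)) (f : ℕ → Eu N → ℝ) (f₀ : Eu N → ℝ) : Prop :=
  (∀ k, MemBV Ω (f k)) ∧ MemBV Ω f₀ ∧
    Tendsto (fun k => eLpNorm (fun x => f k x - f₀ x) 1 (vol Ω)) atTop (𝓝 0) ∧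
    ∃ (μ : ℕ → Fin N → SignedMeasure Ω) (μ₀ : Fin N → SignedMeasure Ω),
      (∀ k, IsDistribGradient Ω (f k) (μ k)) ∧ IsDistribGradient Ω f₀ μ₀ ∧
        ∀ (φ : C₀(Ω, ℝ)) (i : Fin N),
          Tendsto (fun k => signedIntegral (μ k i) φ) atTop (𝓝 (signedIntegral (μ₀ i) φ))

/-- `y_k ⇀ y` weakly in `L²(Ω)`. -/
def L2WeakConv {N : ℕ} (Ω : Opens (Eu N)) (y : ℕ → Eu N → ℝ) (y₀ : Eu N → ℝ) : Prop :=
  (∀ k, MemLp (y k) 2 (vol Ω)) ∧ MemLp y₀ 2 (vol Ω) ∧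
    ∀ g : Eu N → ℝ, MemLp g 2 (vol Ω) →
      Tendsto (fun k => ∫ x, y k x * g x ∂(vol Ω)) atTop (𝓝 (∫ x, y₀ x * g x ∂(vol Ω)))

/-- A sequence `v_k ∈ L²(Ω, dμ_k)` of vector fields is bounded in the variable space. -/
def VarBounded {N : ℕ} (μ : ℕ → Measure (Eu N)) (v : ℕ → Eu N → Eu N) : Prop :=
  (∀ k, MemLp (v k) 2 (μ k)) ∧ limsup (fun k => ∫⁻ x, ‖v k x‖ₑ ^ 2 ∂(μ k)) atTop < ⊤

/-- `v_k ⇀ v` in the variable space `L²(Ω, dμ_k)^N`, with `v ∈ L²(Ω, dμ)^N`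
(the measures are carried by `Ω`). -/
def VarWeakConv {N : ℕ} (Ω : Opens (Eu N)) (μ : ℕ → Measure (Eu N)) (μ₀ : Measure (Eu N))
    (v : ℕ → Eu N → Eu N) (v₀ : Eu N → Eu N) : Prop :=
  VarBounded μ v ∧ MemLp v₀ 2 μ₀ ∧
    ∀ φ : 𝓓(Ω, ℝ),
      Tendsto (fun k => ∫ x, φ x • v k x ∂(μ k)) atTop (𝓝 (∫ x, φ x • v₀ x ∂μ₀))

/-- `ρ ∈ R_ad`, the set of admissible controls. -/
def Admissible {N : ℕ} (Ω : Opens (Eu N)) (ξ₁ ξ₂ : Eu N → ℝ) (m : ℝ) (ρ : Eu N → ℝ) : Prop :=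
  IsWeight Ω ρ ∧ MemBV Ω ρ ∧ ∫ x, ρ x ∂(vol Ω) = m ∧
    ∀ᵐ x ∂(vol Ω), ξ₁ x ≤ ρ x ∧ ρ x ≤ ξ₂ x

/-- The integral identity of the problem `-div(ρ∇y) + y = f` in `Ω`, `y = 0` on `Γ_D`,
`ρ ∂y/∂ν = 0` on the rest of the boundary. -/
def WeakIdentity {N : ℕ} (Ω : Opens (Eu N)) (ΓD : Set (Eu N)) (f ρ y : Eu N → ℝ) : Prop :=
  ∀ φ : 𝓓((⊤ : Opens (Eu N)), ℝ), VanishesOn ΓD φ →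
    ∫ x, (ρ x * inner ℝ (weakGradient Ω y x) (gradient φ x) + y x * φ x) ∂(vol Ω)
      = ∫ x, f x * φ x ∂(vol Ω)

/-- The set `Ξ_W` of weak admissible pairs `(ρ, y)`. -/
def XiW {N : ℕ} (Ω : Opens (Eu N)) (ΓD : Set (Eu N)) (ξ₁ ξ₂ : Eu N → ℝ) (m : ℝ)
    (f : Eu N → ℝ) : Set ((Eu N → ℝ) × (Eu N → ℝ)) :=
  {p | Admissible Ω ξ₁ ξ₂ m p.1 ∧ MemWρ Ω ΓD p.1 p.2 ∧ WeakIdentity Ω ΓD f p.1 p.2}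

/-- Boundedness of a sequence of pairs `(ρ_k, y_k)`. -/
def BoundedPairs {N : ℕ} (Ω : Opens (Eu N)) (p : ℕ → (Eu N → ℝ) × (Eu N → ℝ)) : Prop :=
  (⨆ k, (bvNorm Ω (p k).1 + eLpNorm (p k).2 2 (vol Ω)
    + eLpNorm (weakGradient Ω (p k).2) 2 (weightedMeasure Ω (p k).1))) < ⊤

/-- `τ`-convergence of a sequence of pairs `(ρ_k, y_k)` to
`(ρ, y) ∈ BV(Ω) × W^{1,1}(Ω)`. -/
def TauConv {N : ℕ} (Ω : Opens (Eu N)) (p : ℕ → (Eu N → ℝ) × (Eu N → ℝ))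
    (ρ y : Eu N → ℝ) : Prop :=
  BoundedPairs Ω p ∧ MemBV Ω ρ ∧ MemW11 Ω y ∧
    BVWeakConv Ω (fun k => (p k).1) ρ ∧
    L2WeakConv Ω (fun k => (p k).2) y ∧
    VarWeakConv Ω (fun k => weightedMeasure Ω (p k).1) (weightedMeasure Ω ρ)
      (fun k => weakGradient Ω (p k).2) (weakGradient Ω y)

end WeightedControl

end

/-! The two-sided bound `ξ₁ ≤ ρ_k ≤ ξ₂` controls everything: `√ρ_k` is dominated by `√ξ₂ ∈ L²` and
`1/√ρ_k` by `1/√ξ₁ ∈ L²`.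

Weights. Writing `ρ_k = √ξ₂ · (ρ_k/√ξ₂)` with the second factor bounded in `L²`, a subsequence of
`ρ_k` converges weakly in `L¹` (`exists_subseq_weak_of_dominated`). The BV bound makes this
convergence strong. On a compact `K ⊂ Ω` the `L¹` norm of the difference `w_k` exceeds that of its
mollification at scale `δ` by at most a constant times `δ`. For fixed `δ` the mollifications tend to
zero by weak convergence. Off `K` the mass is small by domination (`tendsto_integral_abs_of_weak`).
A further subsequence converges almost everywhere, so the limit `ρ` inherits the bounds by `ξ₁` and
`ξ₂` and is a weight. The measures `Dρ_k` come from Hahn–Banach and Riesz representation. Their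
weak* convergence follows from convergence on test functions, density in `C₀(Ω)` and a uniform bound
(`bvWeakConv_of_tendsto`).

States. `y_k` and `u_k = √ρ_k ∇y_k` are bounded in the fixed space `L²(Ω)`, so along a subsequence
they converge weakly to some `y` and `u`. Put `v = u/√ρ`. The integrals of `u_k · g_k` pass to the
limit whenever the `g_k` converge a.e. and are dominated in `L²`
(`tendsto_integral_inner_of_weak_of_dominated`). Three choices of `g_k` finish the proof in
`tendsto_weighted_gradients`: `φ/√ρ_k e_i` shows that `v` is the weak gradient of `y`; `(√ξ₁/√ρ_k)
g` gives weak `L²` convergence of `√ξ₁ ∇y_k` to `√ξ₁ v`; `√ρ_k φ e_i` is convergence in the variable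
space. The second choice puts `y` in `W^{1,1}(Ω; Γ_D)`: the pairs `(z, w) ∈ L² × L²` with `(z,
w/√ξ₁)` in the `L¹` closure of the pairs `(φ, ∇φ)` form a closed subspace of a Hilbert space, hence
a weakly closed one. -/

/-- Bounded sequences of a separable Hilbert space have weakly convergent subsequences. -/
theorem exists_subseq_tendsto_inner {H : Type*} [NormedAddCommGroup H] [InnerProductSpace ℝ H]
    [CompleteSpace H] [SeparableSpace H] {x : ℕ → H} {C : ℝ} (hx : ∀ n, ‖x n‖ ≤ C) :
    ∃ (x₀ : H) (σ : ℕ → ℕ), StrictMono σ ∧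
      ∀ z, Tendsto (fun n => inner ℝ (x (σ n)) z) atTop (𝓝 (inner ℝ x₀ z)) := by
  -- Sequential Banach–Alaoglu, valid because `H` is separable; the Riesz isometry moves it from the
  -- dual to `H`.
  have hc := WeakDual.isSeqCompact_closedBall ℝ H (0 : StrongDual ℝ H) C
  obtain ⟨a, -, σ, hσ, ha⟩ := hc (x := fun n =>
    StrongDual.toWeakDual (InnerProductSpace.toDual ℝ H (x n))) (fun n => by
      change InnerProductSpace.toDual ℝ H (x n) ∈ Metric.closedBall 0 C
      simpa using hx n)
  refine ⟨(InnerProductSpace.toDual ℝ H).symm (WeakDual.toStrongDual a), σ, hσ, fun z => ?_⟩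
  have h := (WeakDual.eval_continuous z).seqContinuous ha
  have e : (inner ℝ ((InnerProductSpace.toDual ℝ H).symm (WeakDual.toStrongDual a)) z : ℝ)
      = a z := by
    rw [InnerProductSpace.toDual_symm_apply]; rfl
  rw [e]
  exact h

/-! ### Weak and strong convergence in `L²` -/

section L2
variable {α : Type*} [MeasurableSpace α] {μ : Measure α}
  {E : Type*} [NormedAddCommGroup E] [InnerProductSpace ℝ E]

theorem integral_inner_eq_inner_toLp {u v : α → E} (hu : MemLp u 2 μ) (hv : MemLp v 2 μ) :
    ∫ x, inner ℝ (u x) (v x) ∂μ = inner ℝ (hu.toLp u) (hv.toLp v) := by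
  rw [L2.inner_def]
  refine integral_congr_ae ?_
  filter_upwards [hu.coeFn_toLp, hv.coeFn_toLp] with x h1 h2
  rw [h1, h2]

theorem norm_toLp_le_toReal {E : Type*} [NormedAddCommGroup E] {u : α → E} (hu : MemLp u 2 μ)
    {C : ℝ≥0∞} (hC : C ≠ ⊤) (h : eLpNorm u 2 μ ≤ C) : ‖hu.toLp u‖ ≤ C.toReal := by
  rw [Lp.norm_toLp]
  exact ENNReal.toReal_mono hC h

/-- Weak sequential compactness of bounded sets of `L²`, for functions. -/
theorem exists_subseq_tendsto_integral_inner [CompleteSpace E] [SecondCountableTopology E]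
    [MeasureTheory.IsSeparable μ] {u : ℕ → α → E}
    (hu : ∀ n, MemLp (u n) 2 μ) {C : ℝ≥0∞} (hC : C ≠ ⊤) (hb : ∀ n, eLpNorm (u n) 2 μ ≤ C) :
    ∃ (u₀ : α → E) (σ : ℕ → ℕ), StrictMono σ ∧ MemLp u₀ 2 μ ∧
      ∀ g, MemLp g 2 μ → Tendsto (fun n => ∫ x, inner ℝ (u (σ n) x) (g x) ∂μ) atTop
        (𝓝 (∫ x, inner ℝ (u₀ x) (g x) ∂μ)) := by
  have : Fact ((2 : ℝ≥0∞) ≠ ⊤) := ⟨by simp⟩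
  obtain ⟨x₀, σ, hσ, h⟩ := exists_subseq_tendsto_inner (x := fun n => (hu n).toLp (u n))
    fun n => norm_toLp_le_toReal (hu n) hC (hb n)
  refine ⟨x₀, σ, hσ, Lp.memLp x₀, fun g hg => ?_⟩
  have := h (hg.toLp g)
  simp_rw [← integral_inner_eq_inner_toLp (hu _) hg] at this
  rw [integral_inner_eq_inner_toLp (Lp.memLp x₀) hg, Lp.toLp_coeFn]
  exact this

theorem abs_integral_inner_le {u v : α → E} (hu : MemLp u 2 μ) (hv : MemLp v 2 μ) :
    |∫ x, inner ℝ (u x) (v x) ∂μ| ≤ (eLpNorm u 2 μ).toReal * (eLpNorm v 2 μ).toReal := by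
  rw [integral_inner_eq_inner_toLp hu hv, ← Lp.norm_toLp u hu, ← Lp.norm_toLp v hv]
  exact abs_real_inner_le_norm _ _

/-- Dominated convergence in `L²`. -/
theorem tendsto_eLpNorm_two_sub_of_dominated {E : Type*} [NormedAddCommGroup E]
    {g : ℕ → α → E} {g₀ : α → E} {G : α → ℝ}
    (hG : MemLp G 2 μ) (hg : ∀ n, AEStronglyMeasurable (g n) μ)
    (hle : ∀ n, ∀ᵐ x ∂μ, ‖g n x‖ ≤ G x)
    (hlim : ∀ᵐ x ∂μ, Tendsto (fun n => g n x) atTop (𝓝 (g₀ x))) :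
    MemLp g₀ 2 μ ∧ Tendsto (fun n => eLpNorm (g n - g₀) 2 μ) atTop (𝓝 0) := by
  have hg₀m : AEStronglyMeasurable g₀ μ := aestronglyMeasurable_of_tendsto_ae atTop hg hlim
  have hle0 : ∀ᵐ x ∂μ, ‖g₀ x‖ ≤ G x := by
    filter_upwards [hlim, ae_all_iff.2 hle] with x h1 h2
    exact le_of_tendsto h1.norm (Eventually.of_forall h2)
  have hg₀ : MemLp g₀ 2 μ := hG.mono' hg₀m hle0
  refine ⟨hg₀, ?_⟩
  have key : Tendsto (fun n => ∫⁻ x, ‖g n x - g₀ x‖ₑ ^ 2 ∂μ) atTop (𝓝 (∫⁻ _, 0 ∂μ)) := by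
    refine tendsto_lintegral_of_dominated_convergence' (fun x => (2 * ‖G x‖ₑ) ^ 2)
      (fun n => (((hg n).sub hg₀m).enorm).pow_const 2) (fun n => ?_) ?_ ?_
    · filter_upwards [hle n, hle0] with x h1 h2
      gcongr
      have h3 : ‖g n x‖ₑ ≤ ‖G x‖ₑ := enorm_le_iff_norm_le.2 (h1.trans (le_abs_self _))
      have h4 : ‖g₀ x‖ₑ ≤ ‖G x‖ₑ := enorm_le_iff_norm_le.2 (h2.trans (le_abs_self _))
      calc ‖g n x - g₀ x‖ₑ ≤ ‖g n x‖ₑ + ‖g₀ x‖ₑ := enorm_sub_le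
        _ ≤ 2 * ‖G x‖ₑ := by rw [two_mul]; gcongr
    · simp_rw [mul_pow]
      rw [lintegral_const_mul' _ _ (by simp)]
      refine ENNReal.mul_ne_top (by simp) ?_
      have := hG.eLpNorm_ne_top
      rw [eLpNorm_eq_lintegral_rpow_enorm_toReal (by simp) (by simp)] at this
      simp only [ENNReal.toReal_ofNat, ENNReal.rpow_ofNat] at this
      intro h
      rw [h] at this
      simp at this
    · filter_upwards [hlim] with x h1
      have h2 : Tendsto (fun n => g n x - g₀ x) atTop (𝓝 0) := by
        simpa using h1.sub_const (g₀ x)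
      have h3 := (ENNReal.continuous_pow 2).tendsto 0 |>.comp (by simpa using h2.enorm)
      simpa [Function.comp_def] using h3
  rw [lintegral_zero] at key
  have h5 := (ENNReal.continuous_rpow_const (y := 1/2)).tendsto 0 |>.comp key
  simp only [eLpNorm_eq_lintegral_rpow_enorm_toReal (p := 2) (by simp) (by simp),
    ENNReal.toReal_ofNat, ENNReal.rpow_ofNat, Pi.sub_apply]
  simpa [Function.comp_def] using h5

/-- Pairing of a weakly convergent and a strongly convergent sequence of `L²`. -/
theorem tendsto_integral_inner_of_weak_of_dominated {u : ℕ → α → E} {u₀ : α → E}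
    (hu : ∀ n, MemLp (u n) 2 μ)
    {C : ℝ≥0∞} (hC : C ≠ ⊤) (hb : ∀ n, eLpNorm (u n) 2 μ ≤ C)
    (hweak : ∀ g, MemLp g 2 μ → Tendsto (fun n => ∫ x, inner ℝ (u n x) (g x) ∂μ) atTop
        (𝓝 (∫ x, inner ℝ (u₀ x) (g x) ∂μ)))
    {g : ℕ → α → E} {g₀ : α → E} {G : α → ℝ}
    (hG : MemLp G 2 μ) (hg : ∀ n, AEStronglyMeasurable (g n) μ)
    (hle : ∀ n, ∀ᵐ x ∂μ, ‖g n x‖ ≤ G x)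
    (hlim : ∀ᵐ x ∂μ, Tendsto (fun n => g n x) atTop (𝓝 (g₀ x))) :
    Tendsto (fun n => ∫ x, inner ℝ (u n x) (g n x) ∂μ) atTop
        (𝓝 (∫ x, inner ℝ (u₀ x) (g₀ x) ∂μ)) := by
  obtain ⟨hg₀, hs⟩ := tendsto_eLpNorm_two_sub_of_dominated hG hg hle hlim
  have hgn : ∀ n, MemLp (g n) 2 μ := fun n => hG.mono' (hg n) (hle n)
  -- The first term converges by weak convergence against the fixed `g₀`; the second is at most `C
  -- ‖g n - g₀‖₂`, which tends to zero.
  have hsplit : ∀ n, ∫ x, inner ℝ (u n x) (g n x) ∂μ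
      = ∫ x, inner ℝ (u n x) (g₀ x) ∂μ + ∫ x, inner ℝ (u n x) ((g n - g₀) x) ∂μ := by
    intro n
    rw [integral_inner_eq_inner_toLp (hu n) (hgn n), integral_inner_eq_inner_toLp (hu n) hg₀,
      integral_inner_eq_inner_toLp (hu n) ((hgn n).sub hg₀), MemLp.toLp_sub (hgn n) hg₀,
      inner_sub_right]
    ring
  simp_rw [hsplit]
  have hz : Tendsto (fun n => ∫ x, inner ℝ (u n x) ((g n - g₀) x) ∂μ) atTop (𝓝 0) := by
    refine squeeze_zero_norm (a := fun n => C.toReal * (eLpNorm (g n - g₀) 2 μ).toReal)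
      (fun n => ?_) ?_
    · refine (abs_integral_inner_le (hu n) ((hgn n).sub hg₀)).trans ?_
      gcongr
      exact hb n
    · have := (ENNReal.tendsto_toReal (by simp)).comp hs
      simpa using this.const_mul C.toReal
  simpa using (hweak g₀ hg₀).add hz
end L2

/-! ### Jordan decomposition and Riesz representation of functionals on `C₀` -/

section SignedRiesz
open scoped CompactlySupported
open CompactlySupportedContinuousMap
variable {X : Type*} [TopologicalSpace X]

/-- A compactly supported nonnegative function as an element of `C₀`. -/
noncomputable def toZeroAtInfty (f : C_c(X, ℝ≥0)) : C₀(X, ℝ) where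
  toFun x := f x
  continuous_toFun := by fun_prop
  zero_at_infty' := f.toReal.hasCompactSupport.is_zero_at_infty.congr fun x => by simp

theorem toZeroAtInfty_apply (f : C_c(X, ℝ≥0)) (x : X) : toZeroAtInfty f x = f x := rfl

theorem toZeroAtInfty_add (f g : C_c(X, ℝ≥0)) :
    toZeroAtInfty (f + g) = toZeroAtInfty f + toZeroAtInfty g := by
  ext x; simp [toZeroAtInfty_apply]

theorem toZeroAtInfty_smul (c : ℝ≥0) (f : C_c(X, ℝ≥0)) :
    toZeroAtInfty (c • f) = (c : ℝ) • toZeroAtInfty f := by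
  ext x; simp [toZeroAtInfty_apply]

theorem norm_toZeroAtInfty_le {f : C_c(X, ℝ≥0)} {c : ℝ≥0} (h : ∀ x, f x ≤ c) :
    ‖toZeroAtInfty f‖ ≤ c := by
  rw [← ZeroAtInftyContinuousMap.norm_toBCF_eq_norm]
  refine (BoundedContinuousFunction.norm_le c.2).2 fun x => ?_
  change ‖((f x : ℝ≥0) : ℝ)‖ ≤ c
  simpa using h x

theorem exists_bound_nnreal (f : C_c(X, ℝ≥0)) : ∃ c : ℝ≥0, ∀ x, f x ≤ c := by
  refine ⟨‖toZeroAtInfty f‖₊, fun x => ?_⟩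
  have h := BoundedContinuousFunction.norm_coe_le_norm (toZeroAtInfty f).toBCF x
  rw [ZeroAtInftyContinuousMap.norm_toBCF_eq_norm] at h
  change ‖((f x : ℝ≥0) : ℝ)‖ ≤ _ at h
  rw [← NNReal.coe_le_coe, coe_nnnorm]
  simpa using h

variable (Λ : C₀(X, ℝ) →L[ℝ] ℝ)

theorem apply_toZeroAtInfty_le {f : C_c(X, ℝ≥0)} {c : ℝ≥0} (h : ∀ x, f x ≤ c) :
    Λ (toZeroAtInfty f) ≤ ‖Λ‖ * c :=
  (le_abs_self _).trans ((Λ.le_opNorm _).trans (by gcongr; exact norm_toZeroAtInfty_le h))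

/-- The positive part of a bounded functional, on nonnegative functions. -/
noncomputable def posPartFun (f : C_c(X, ℝ≥0)) : ℝ :=
  sSup ((fun g : C_c(X, ℝ≥0) => Λ (toZeroAtInfty g)) '' {g | g ≤ f})

theorem posPartFun_bddAbove (f : C_c(X, ℝ≥0)) :
    BddAbove ((fun g : C_c(X, ℝ≥0) => Λ (toZeroAtInfty g)) '' {g | g ≤ f}) := by
  obtain ⟨c, hc⟩ := exists_bound_nnreal f
  refine ⟨‖Λ‖ * c, ?_⟩
  rintro _ ⟨g, hg, rfl⟩
  exact apply_toZeroAtInfty_le Λ fun x => (hg x).trans (hc x)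

theorem le_posPartFun {f g : C_c(X, ℝ≥0)} (h : g ≤ f) :
    Λ (toZeroAtInfty g) ≤ posPartFun Λ f :=
  le_csSup (posPartFun_bddAbove Λ f) ⟨g, h, rfl⟩

theorem posPartFun_le {f : C_c(X, ℝ≥0)} {a : ℝ}
    (h : ∀ g ≤ f, Λ (toZeroAtInfty g) ≤ a) : posPartFun Λ f ≤ a := by
  refine csSup_le ⟨_, f, le_refl f, rfl⟩ ?_
  rintro _ ⟨g, hg, rfl⟩
  exact h g hg

theorem posPartFun_nonneg (f : C_c(X, ℝ≥0)) : 0 ≤ posPartFun Λ f := by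
  have h := le_posPartFun Λ (f := f) (g := 0) (fun x => by simp)
  have e : toZeroAtInfty (0 : C_c(X, ℝ≥0)) = 0 := by ext x; simp [toZeroAtInfty_apply]
  simpa [e] using h

theorem posPartFun_le_norm {f : C_c(X, ℝ≥0)} {c : ℝ≥0} (h : ∀ x, f x ≤ c) :
    posPartFun Λ f ≤ ‖Λ‖ * c :=
  posPartFun_le Λ fun _ hg => apply_toZeroAtInfty_le Λ fun x => (hg x).trans (h x)

/-- Riesz decomposition: if `h ≤ f + g`, then `h` is the sum of `h ⊓ f ≤ f` and a remainder that is
at most `g`. Additivity is what makes the supremum a linear functional. -/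
theorem posPartFun_add (f g : C_c(X, ℝ≥0)) :
    posPartFun Λ (f + g) = posPartFun Λ f + posPartFun Λ g := by
  refine le_antisymm (posPartFun_le Λ fun h hh => ?_) ?_
  · obtain ⟨k, hk⟩ := CompactlySupportedContinuousMap.exists_add_of_le
      (show h ⊓ f ≤ h from inf_le_left)
    have hk2 : k ≤ g := by
      intro x
      have h1 := DFunLike.congr_fun hk x
      have h2 := hh x
      simp only [CompactlySupportedContinuousMap.coe_add, Pi.add_apply,
        CompactlySupportedContinuousMap.coe_inf, Pi.inf_apply] at h1 h2
      change k x ≤ g x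
      change h x ≤ f x + g x at h2
      rcases le_total (h x) (f x) with h3 | h3
      · rw [inf_eq_left.2 h3] at h1
        have : k x = 0 := by simpa using h1
        simp [this]
      · rw [inf_eq_right.2 h3] at h1
        rw [← h1] at h2
        exact le_of_add_le_add_left h2
    rw [← hk, toZeroAtInfty_add, map_add]
    exact add_le_add (le_posPartFun Λ inf_le_right) (le_posPartFun Λ hk2)
  · rw [← le_sub_iff_add_le]
    refine posPartFun_le Λ fun h hh => ?_
    rw [le_sub_iff_add_le, ← le_sub_iff_add_le']
    refine posPartFun_le Λ fun k hk => ?_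
    rw [le_sub_iff_add_le', ← map_add, ← toZeroAtInfty_add]
    exact le_posPartFun Λ fun x => add_le_add (hh x) (hk x)

theorem posPartFun_smul_le (c : ℝ≥0) (f : C_c(X, ℝ≥0)) :
    (c : ℝ) * posPartFun Λ f ≤ posPartFun Λ (c • f) := by
  rcases eq_or_ne c 0 with rfl | hc
  · simpa using posPartFun_nonneg Λ _
  have hc' : (0 : ℝ) < c := by positivity
  rw [← le_div_iff₀' hc']
  refine posPartFun_le Λ fun g hg => ?_
  rw [le_div_iff₀' hc']
  have := le_posPartFun Λ (f := c • f) (g := c • g) (fun x => mul_le_mul_right (hg x) c)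
  rwa [toZeroAtInfty_smul, map_smul] at this

theorem posPartFun_smul (c : ℝ≥0) (f : C_c(X, ℝ≥0)) :
    posPartFun Λ (c • f) = c * posPartFun Λ f := by
  refine le_antisymm ?_ (posPartFun_smul_le Λ c f)
  rcases eq_or_ne c 0 with rfl | hc
  · have := posPartFun_le_norm Λ (f := (0 : ℝ≥0) • f) (c := 0) (fun x => by simp)
    simpa using this
  have h := posPartFun_smul_le Λ c⁻¹ (c • f)
  rw [smul_smul, inv_mul_cancel₀ hc, one_smul, NNReal.coe_inv] at h
  have hc' : (0 : ℝ) < c := by positivity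
  rwa [inv_mul_le_iff₀ hc'] at h

/-- The positive part of a bounded functional on `C₀`, as a linear functional. -/
noncomputable def posPartLinear : C_c(X, ℝ≥0) →ₗ[ℝ≥0] ℝ≥0 where
  toFun f := ⟨posPartFun Λ f, posPartFun_nonneg Λ f⟩
  map_add' f g := NNReal.eq (posPartFun_add Λ f g)
  map_smul' c f := NNReal.eq (posPartFun_smul Λ c f)

theorem coe_posPartLinear (f : C_c(X, ℝ≥0)) : (posPartLinear Λ f : ℝ) = posPartFun Λ f := rfl

/-- For `g ≤ f` write `f = g + h`; then `Λ g = Λ f + (-Λ) h` and `h` competes in the supremum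
defining the positive part of `-Λ`. Applied to `Λ` and to `-Λ`, this gives the Jordan decomposition
of `Λ`. -/
theorem posPartFun_le_add_neg (f : C_c(X, ℝ≥0)) :
    posPartFun Λ f ≤ Λ (toZeroAtInfty f) + posPartFun (-Λ) f := by
  refine posPartFun_le Λ fun g hg => ?_
  obtain ⟨h, hh⟩ := CompactlySupportedContinuousMap.exists_add_of_le hg
  have h1 : Λ (toZeroAtInfty f) = Λ (toZeroAtInfty g) + Λ (toZeroAtInfty h) := by
    rw [← hh, toZeroAtInfty_add, map_add]
  have h2 := le_posPartFun (-Λ) (f := f) (g := h) (fun x => by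
    rw [← hh]; exact le_add_of_nonneg_left zero_le)
  change -Λ (toZeroAtInfty h) ≤ _ at h2
  linarith

theorem posPartFun_sub_neg (f : C_c(X, ℝ≥0)) :
    posPartFun Λ f - posPartFun (-Λ) f = Λ (toZeroAtInfty f) := by
  have h1 := posPartFun_le_add_neg Λ f
  have h2 := posPartFun_le_add_neg (-Λ) f
  rw [show - -Λ = Λ from neg_neg Λ] at h2
  change _ ≤ -Λ _ + _ at h2
  linarith

variable [T2Space X] [LocallyCompactSpace X] [MeasurableSpace X] [BorelSpace X]

/-- By inner regularity it suffices to bound compact sets. A Urysohn function with values in `[0,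
1]` dominates the indicator of `K`, and the positive part of `Λ` is at most `‖Λ‖` on it. -/
theorem rieszMeasure_posPartLinear_univ_le :
    NNRealRMK.rieszMeasure (posPartLinear Λ) Set.univ ≤ ENNReal.ofReal ‖Λ‖ := by
  rw [isOpen_univ.measure_eq_iSup_isCompact]
  refine iSup_le fun K => iSup_le fun _ => iSup_le fun hK => ?_
  obtain ⟨f, hf1, -, hfc, hf01⟩ :=
    exists_continuous_one_zero_of_isCompact hK isClosed_empty (Set.disjoint_empty K)
  let F : C_c(X, ℝ≥0) := nnrealPart ⟨f, hfc⟩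
  have hF : ∀ x, F x = (f x).toNNReal := fun x => rfl
  calc NNRealRMK.rieszMeasure (posPartLinear Λ) K
      = ∫⁻ x, K.indicator 1 x ∂(NNRealRMK.rieszMeasure (posPartLinear Λ)) := by
        rw [lintegral_indicator_one hK.measurableSet]
    _ ≤ ∫⁻ x, F x ∂(NNRealRMK.rieszMeasure (posPartLinear Λ)) := by
        refine lintegral_mono (Set.indicator_le fun y hy => ?_)
        rw [hF, hf1 hy]
        simp
    _ = ENNReal.ofReal (posPartFun Λ F) := by
        rw [NNRealRMK.lintegral_rieszMeasure, ← ENNReal.ofReal_coe_nnreal, coe_posPartLinear]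
    _ ≤ ENNReal.ofReal ‖Λ‖ := by
        refine ENNReal.ofReal_le_ofReal ?_
        have := posPartFun_le_norm Λ (f := F) (c := 1) fun x => by
          rw [hF]; simpa using (hf01 x).2
        simpa using this

/-- Riesz representation of bounded functionals on `C₀` by differences of finite measures. -/
theorem exists_measures_of_dual (Λ : C₀(X, ℝ) →L[ℝ] ℝ) :
    ∃ m₁ m₂ : Measure X, m₁ Set.univ ≤ ENNReal.ofReal ‖Λ‖ ∧ m₂ Set.univ ≤ ENNReal.ofReal ‖Λ‖ ∧
      ∀ φ : C₀(X, ℝ), HasCompactSupport φ → Λ φ = ∫ x, φ x ∂m₁ - ∫ x, φ x ∂m₂ := by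
  refine ⟨NNRealRMK.rieszMeasure (posPartLinear Λ), NNRealRMK.rieszMeasure (posPartLinear (-Λ)),
    rieszMeasure_posPartLinear_univ_le Λ, ?_, fun φ hφ => ?_⟩
  · exact (rieszMeasure_posPartLinear_univ_le (-Λ)).trans_eq
      (congrArg ENNReal.ofReal (ContinuousLinearMap.opNorm_neg Λ))
  have hnn : ∀ f : C_c(X, ℝ≥0), Λ (toZeroAtInfty f)
      = ∫ x, toZeroAtInfty f x ∂(NNRealRMK.rieszMeasure (posPartLinear Λ))
        - ∫ x, toZeroAtInfty f x ∂(NNRealRMK.rieszMeasure (posPartLinear (-Λ))) := by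
    intro f
    simp only [toZeroAtInfty_apply]
    rw [NNRealRMK.integral_rieszMeasure, NNRealRMK.integral_rieszMeasure, coe_posPartLinear,
      coe_posPartLinear, posPartFun_sub_neg]
  let ψ : C_c(X, ℝ) := ⟨φ.toContinuousMap, hφ⟩
  -- Both `φ⁺` and `φ⁻` are compactly supported and nonnegative, so the representation on such
  -- functions applies to each.
  have hdec : φ = toZeroAtInfty ψ.nnrealPart - toZeroAtInfty (-ψ).nnrealPart := by
    ext x
    have h : φ x = ψ x := rfl
    simp [toZeroAtInfty_apply, h]
  have h_int : ∀ (f : C_c(X, ℝ≥0)) (L : C_c(X, ℝ≥0) →ₗ[ℝ≥0] ℝ≥0),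
      Integrable (toZeroAtInfty f) (NNRealRMK.rieszMeasure L) := fun f L => by
    have := f.toReal.continuous.integrable_of_hasCompactSupport f.toReal.hasCompactSupport
      (μ := NNRealRMK.rieszMeasure L)
    refine this.congr (Eventually.of_forall fun x => ?_)
    simp [toZeroAtInfty_apply]
  rw [hdec, map_sub, hnn, hnn]
  simp only [ZeroAtInftyContinuousMap.sub_apply]
  rw [integral_sub (h_int _ _) (h_int _ _), integral_sub (h_int _ _) (h_int _ _)]
  ring
end SignedRiesz

/-! ### Distributional gradients of BV functions as signed measures -/

namespace WeightedControl

/-- The pair `(m₁, m₂)` need not be mutually singular, so it may differ from the Jordan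
decomposition used by `signedIntegral`. The two decompositions represent the same signed measure,
and cross-adding gives an equality of positive measures against which the bounded `φ` can be
integrated. -/
theorem signedIntegral_sub {X : Type*} [MeasurableSpace X] (m₁ m₂ : Measure X)
    [IsFiniteMeasure m₁] [IsFiniteMeasure m₂] {φ : X → ℝ} (hφ : Measurable φ) {c : ℝ}
    (hb : ∀ x, |φ x| ≤ c) :
    signedIntegral (m₁.toSignedMeasure - m₂.toSignedMeasure) φ = ∫ x, φ x ∂m₁ - ∫ x, φ x ∂m₂ := by
  set s := m₁.toSignedMeasure - m₂.toSignedMeasure with hs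
  have h := s.toSignedMeasure_toJordanDecomposition
  unfold signedIntegral
  set j := s.toJordanDecomposition
  have he : j.posPart + m₂ = m₁ + j.negPart := by
    rw [← Measure.toSignedMeasure_eq_toSignedMeasure_iff, Measure.toSignedMeasure_add,
      Measure.toSignedMeasure_add]
    unfold JordanDecomposition.toSignedMeasure at h
    rw [hs, sub_eq_sub_iff_add_eq_add] at h
    exact h
  have h_int : ∀ m : Measure X, IsFiniteMeasure m → Integrable φ m := fun m _ =>
    Integrable.of_bound hφ.aestronglyMeasurable c (Eventually.of_forall hb)
  have h2 := congrArg (fun m => ∫ x, φ x ∂m) he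
  rw [integral_add_measure (h_int _ inferInstance) (h_int _ inferInstance),
    integral_add_measure (h_int _ inferInstance) (h_int _ inferInstance)] at h2
  linarith

end WeightedControl

namespace WeightedControl
variable {N : ℕ} {Ω : Opens (Eu N)}

/-- The field `φ h` for a scalar test function `φ` and a vector `h`. -/
noncomputable def smulField (φ : Eu N → ℝ) (hφ : ContDiff ℝ 1 φ) (hc : HasCompactSupport φ)
    (hs : tsupport φ ⊆ Ω) (h : Eu N) : 𝓓^{1}(Ω, Eu N) where
  toFun x := φ x • h
  contDiff' := by
    change ContDiff ℝ 1 _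
    fun_prop
  hasCompactSupport' := hc.smul_right
  tsupport_subset' := (tsupport_smul_subset_left φ _).trans hs

theorem divergence_smulField {φ : Eu N → ℝ} (hφ : ContDiff ℝ 1 φ) (hc : HasCompactSupport φ)
    (hs : tsupport φ ⊆ Ω) (h x : Eu N) :
    divergence (smulField φ hφ hc hs h) x = fderiv ℝ φ x h := by
  have hd : DifferentiableAt ℝ φ x := hφ.differentiable (by simp) x
  have h1 : fderiv ℝ (smulField φ hφ hc hs h) x = (fderiv ℝ φ x).smulRight h :=
    (hd.hasFDerivAt.smul_const h).fderiv
  unfold divergence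
  rw [h1]
  have h2 : h = ∑ i, h i • stdVec i := by
    ext j
    simp [Finset.sum_apply, Pi.single_apply]
  conv_rhs => rw [h2, map_sum]
  refine Finset.sum_congr rfl fun i _ => ?_
  simp [mul_comm]

/-- Test fields bounded by `a` have integral against `f` bounded by `a` times the variation. -/
theorem abs_integral_mul_fderiv_le {f : Eu N → ℝ} {C : ℝ} (hC : 0 ≤ C)
    (hf : totalVariation Ω f ≤ ENNReal.ofReal C) {φ : Eu N → ℝ} (hφ : ContDiff ℝ 1 φ)
    (hc : HasCompactSupport φ) (hs : tsupport φ ⊆ Ω) (h : Eu N) {a : ℝ} (ha : 0 < a)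
    (hb : ∀ x, |φ x| * ‖h‖ ≤ a) :
    |∫ x, f x * fderiv ℝ φ x h ∂(vol Ω)| ≤ C * a := by
  -- Scaling by `±1/a` makes the field `φ h` admissible in the supremum defining the variation; the
  -- two signs give the absolute value.
  have key : ∀ c : ℝ, |c| = a⁻¹ → c * ∫ x, f x * fderiv ℝ φ x h ∂(vol Ω) ≤ C := by
    intro c hca
    have h1 : ENNReal.ofReal (∫ x, f x * divergence (smulField φ hφ hc hs (c • h)) x ∂(vol Ω))
        ≤ ENNReal.ofReal C := by
      refine le_trans ?_ hf
      refine le_iSup₂_of_le (smulField φ hφ hc hs (c • h)) (fun x => ?_) le_rfl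
      change ‖φ x • c • h‖ ≤ 1
      rw [norm_smul, norm_smul, Real.norm_eq_abs, Real.norm_eq_abs, hca]
      calc |φ x| * (a⁻¹ * ‖h‖) = a⁻¹ * (|φ x| * ‖h‖) := by ring
        _ ≤ a⁻¹ * a := by gcongr; exact hb x
        _ = 1 := inv_mul_cancel₀ ha.ne'
    rw [ENNReal.ofReal_le_ofReal_iff hC] at h1
    simp_rw [divergence_smulField, map_smul, smul_eq_mul, mul_left_comm _ c] at h1
    rwa [integral_const_mul] at h1
  have k1 := key a⁻¹ (abs_of_pos (inv_pos.2 ha))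
  have k2 := key (-a⁻¹) (by rw [abs_neg, abs_of_pos (inv_pos.2 ha)])
  rw [inv_mul_le_iff₀ ha] at k1
  rw [neg_mul, ← mul_neg, inv_mul_le_iff₀ ha] at k2
  rw [abs_le]
  constructor <;> linarith

theorem testFunction_apply_eq_zero (φ : 𝓓(Ω, ℝ)) {x : Eu N} (hx : x ∉ Ω) : φ x = 0 :=
  image_eq_zero_of_notMem_tsupport fun h => hx (φ.tsupport_subset h)

theorem hasCompactSupport_comp_val (φ : 𝓓(Ω, ℝ)) : HasCompactSupport fun x : Ω => φ x := by
  have hK : IsCompact (Subtype.val ⁻¹' (tsupport φ) : Set Ω) :=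
    Topology.IsInducing.subtypeVal.isCompact_preimage' φ.hasCompactSupport
      (by simpa using φ.tsupport_subset)
  exact HasCompactSupport.intro hK fun x hx => image_eq_zero_of_notMem_tsupport (f := φ) hx

/-- The restriction of a test function to `Ω`. -/
noncomputable def restrictZeroAtInfty (Ω : Opens (Eu N)) : 𝓓(Ω, ℝ) →ₗ[ℝ] C₀(Ω, ℝ) where
  toFun φ :=
    { toFun := fun x => φ x
      continuous_toFun := φ.continuous.comp continuous_subtype_val
      zero_at_infty' := by
        exact (hasCompactSupport_comp_val φ).is_zero_at_infty }
  map_add' _ _ := rfl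
  map_smul' _ _ := rfl

theorem hasCompactSupport_restrictZeroAtInfty (φ : 𝓓(Ω, ℝ)) :
    HasCompactSupport (restrictZeroAtInfty Ω φ) := hasCompactSupport_comp_val φ

theorem restrictZeroAtInfty_injective : Function.Injective (restrictZeroAtInfty Ω) := by
  intro φ ψ h
  ext x
  by_cases hx : x ∈ Ω
  · exact DFunLike.congr_fun h (⟨x, hx⟩ : Ω)
  · rw [testFunction_apply_eq_zero φ hx, testFunction_apply_eq_zero ψ hx]

theorem abs_zeroAtInfty_apply_le {X : Type*} [TopologicalSpace X] (φ : C₀(X, ℝ)) (x : X) :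
    |φ x| ≤ ‖φ‖ := by
  have h := BoundedContinuousFunction.norm_coe_le_norm φ.toBCF x
  rwa [ZeroAtInftyContinuousMap.norm_toBCF_eq_norm] at h

theorem zeroAtInfty_norm_le {X : Type*} [TopologicalSpace X] {φ : C₀(X, ℝ)} {a : ℝ} (ha : 0 ≤ a)
    (h : ∀ x, |φ x| ≤ a) : ‖φ‖ ≤ a := by
  rw [← ZeroAtInftyContinuousMap.norm_toBCF_eq_norm]
  exact (BoundedContinuousFunction.norm_le ha).2 h

theorem abs_testFunction_apply_le (φ : 𝓓(Ω, ℝ)) (x : Eu N) : |φ x| ≤ ‖restrictZeroAtInfty Ω φ‖ := by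
  by_cases hx : x ∈ Ω
  · exact abs_zeroAtInfty_apply_le (restrictZeroAtInfty Ω φ) ⟨x, hx⟩
  · rw [testFunction_apply_eq_zero φ hx]; simp

theorem integrable_mul_continuous_of_hasCompactSupport {f : Eu N → ℝ} {μ : Measure (Eu N)}
    (hf : Integrable f μ) {g : Eu N → ℝ} (hg : Continuous g) (hc : HasCompactSupport g) :
    Integrable (fun x => f x * g x) μ := by
  obtain ⟨c, hc⟩ := hg.bounded_above_of_compact_support hc
  exact hf.mul_bdd hg.aestronglyMeasurable (Eventually.of_forall hc)

theorem integrable_mul_fderiv {f : Eu N → ℝ} {μ : Measure (Eu N)}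
    (hf : Integrable f μ) {g : Eu N → ℝ} (hg : ContDiff ℝ 1 g) (hc : HasCompactSupport g)
    (h : Eu N) : Integrable (fun x => f x * fderiv ℝ g x h) μ :=
  integrable_mul_continuous_of_hasCompactSupport hf
    ((hg.continuous_fderiv (by simp)).clm_apply continuous_const) (hc.fderiv_apply ℝ h)

theorem contDiff_one_testFunction {Ω : Opens (Eu N)} (φ : 𝓓(Ω, ℝ)) : ContDiff ℝ 1 φ :=
  φ.contDiff.of_le (by exact_mod_cast le_top)

/-- The functional `φ ↦ -∫ f ∂_i φ` on test functions. -/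
noncomputable def distribDeriv {f : Eu N → ℝ} (hf : Integrable f (vol Ω)) (i : Fin N) :
    𝓓(Ω, ℝ) →ₗ[ℝ] ℝ where
  toFun φ := -∫ x, f x * fderiv ℝ φ x (stdVec i) ∂(vol Ω)
  map_add' φ ψ := by
    have hd : ∀ x, fderiv ℝ (φ + ψ : 𝓓(Ω, ℝ)) x = fderiv ℝ φ x + fderiv ℝ ψ x := fun x =>
      fderiv_add ((contDiff_one_testFunction φ).differentiable (by simp) x)
        ((contDiff_one_testFunction ψ).differentiable (by simp) x)
    simp_rw [hd, add_apply, mul_add]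
    rw [integral_add (integrable_mul_fderiv hf (contDiff_one_testFunction φ) φ.hasCompactSupport _)
      (integrable_mul_fderiv hf (contDiff_one_testFunction ψ) ψ.hasCompactSupport _), neg_add]
  map_smul' c φ := by
    have hd : ∀ x, fderiv ℝ (c • φ : 𝓓(Ω, ℝ)) x = c • fderiv ℝ φ x := fun x =>
      fderiv_const_smul ((contDiff_one_testFunction φ).differentiable (by simp) x) c
    simp_rw [hd, smul_apply, smul_eq_mul, mul_left_comm _ c]
    rw [integral_const_mul, RingHom.id_apply, mul_neg]

theorem abs_distribDeriv_le {f : Eu N → ℝ} (hf : Integrable f (vol Ω)) {C : ℝ} (hC : 0 ≤ C)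
    (hv : totalVariation Ω f ≤ ENNReal.ofReal C) (i : Fin N) (φ : 𝓓(Ω, ℝ)) :
    |distribDeriv hf i φ| ≤ C * ‖restrictZeroAtInfty Ω φ‖ := by
  change |-∫ x, f x * fderiv ℝ φ x (stdVec i) ∂(vol Ω)| ≤ _
  rw [abs_neg]
  -- The preceding estimate needs a positive bound `a`, while the sup norm may vanish; it is
  -- enlarged by `ε / (C + 1)`, at a cost of at most `ε`.
  refine le_of_forall_pos_le_add fun ε hε => ?_
  have hd : 0 < ε / (C + 1) := by positivity
  have := abs_integral_mul_fderiv_le hC hv (contDiff_one_testFunction φ) φ.hasCompactSupport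
    φ.tsupport_subset (stdVec i) (a := ‖restrictZeroAtInfty Ω φ‖ + ε / (C + 1))
    (by positivity) (fun x => by
      have := abs_testFunction_apply_le φ x
      simp only [stdVec, PiLp.norm_single, norm_one, mul_one]
      linarith)
  refine this.trans ?_
  rw [mul_add]
  gcongr
  rw [mul_div_assoc', div_le_iff₀ (by positivity)]
  nlinarith

/-- Extension to `E` of a functional on `V` that is bounded for the norm induced by an injection of
`V` into `E`. -/
theorem exists_dual_comp_eq {V E : Type*} [AddCommGroup V] [Module ℝ V] [NormedAddCommGroup E]
    [NormedSpace ℝ E] (T : V →ₗ[ℝ] E) (hT : Function.Injective T) (L : V →ₗ[ℝ] ℝ) {C : ℝ}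
    (hC : 0 ≤ C) (hL : ∀ v, |L v| ≤ C * ‖T v‖) :
    ∃ Λ : E →L[ℝ] ℝ, (∀ v, Λ (T v) = L v) ∧ ‖Λ‖ ≤ C := by
  let e := LinearEquiv.ofInjective T hT
  let F : StrongDual ℝ (LinearMap.range T) :=
    LinearMap.mkContinuous (L.comp e.symm.toLinearMap) C (fun x => by
      have h1 := hL (e.symm x)
      have h2 : T (e.symm x) = x := congrArg Subtype.val (e.apply_symm_apply x)
      rw [h2] at h1
      exact h1)
  -- Hahn–Banach: `L` descends to the range of `T`, bounded by `C` for the norm of `E`, and extends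
  -- without increasing its norm.
  obtain ⟨Λ, hΛ, hΛn⟩ := exists_extension_norm_eq _ F
  refine ⟨Λ, fun v => ?_, hΛn.trans_le (LinearMap.mkContinuous_norm_le _ hC _)⟩
  have := hΛ (e v)
  change Λ (T v) = L (e.symm (e v)) at this
  rwa [e.symm_apply_apply] at this

/-- Riesz representation of bounded functionals on `C₀` by signed measures. -/
theorem exists_signedMeasure_of_dual {X : Type*} [TopologicalSpace X] [T2Space X]
    [LocallyCompactSpace X] [MeasurableSpace X] [BorelSpace X] (Λ : C₀(X, ℝ) →L[ℝ] ℝ) {C : ℝ}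
    (hC : 0 ≤ C) (hΛC : ‖Λ‖ ≤ C) :
    ∃ ν : SignedMeasure X, (∀ φ : C₀(X, ℝ), HasCompactSupport φ → signedIntegral ν φ = Λ φ) ∧
      ∀ φ ψ : C₀(X, ℝ), |signedIntegral ν φ - signedIntegral ν ψ| ≤ 2 * C * ‖φ - ψ‖ := by
  obtain ⟨m₁, m₂, hm₁, hm₂, hrep⟩ := exists_measures_of_dual Λ
  have hm₁C : m₁ Set.univ ≤ ENNReal.ofReal C := hm₁.trans (ENNReal.ofReal_le_ofReal hΛC)
  have hm₂C : m₂ Set.univ ≤ ENNReal.ofReal C := hm₂.trans (ENNReal.ofReal_le_ofReal hΛC)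
  have hf₁ : IsFiniteMeasure m₁ := ⟨hm₁C.trans_lt ENNReal.ofReal_lt_top⟩
  have hf₂ : IsFiniteMeasure m₂ := ⟨hm₂C.trans_lt ENNReal.ofReal_lt_top⟩
  have hsi : ∀ φ : C₀(X, ℝ), signedIntegral (m₁.toSignedMeasure - m₂.toSignedMeasure) φ
      = ∫ x, φ x ∂m₁ - ∫ x, φ x ∂m₂ := fun φ =>
    signedIntegral_sub m₁ m₂ φ.continuous.measurable (abs_zeroAtInfty_apply_le φ)
  have h_int : ∀ (m : Measure X) (φ : C₀(X, ℝ)), IsFiniteMeasure m → Integrable φ m :=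
    fun m φ _ => Integrable.of_bound φ.continuous.measurable.aestronglyMeasurable ‖φ‖
      (Eventually.of_forall (abs_zeroAtInfty_apply_le φ))
  have hbd : ∀ (m : Measure X), IsFiniteMeasure m → m Set.univ ≤ ENNReal.ofReal C →
      ∀ φ ψ : C₀(X, ℝ), |∫ x, φ x ∂m - ∫ x, ψ x ∂m| ≤ C * ‖φ - ψ‖ := by
    intro m hm hmC φ ψ
    rw [← integral_sub (h_int m φ hm) (h_int m ψ hm)]
    have h1 := norm_integral_le_of_norm_le_const (μ := m) (f := fun x => φ x - ψ x)
      (Eventually.of_forall fun x => abs_zeroAtInfty_apply_le (φ - ψ) x)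
    refine h1.trans ?_
    rw [mul_comm]
    gcongr
    exact ENNReal.toReal_le_of_le_ofReal hC hmC
  refine ⟨m₁.toSignedMeasure - m₂.toSignedMeasure, fun φ hφ => ?_, fun φ ψ => ?_⟩
  · rw [hsi, hrep φ hφ]
  -- Each of the two measures has mass at most `C`, whence the constant `2 * C`.
  · rw [hsi, hsi]
    have h1 := abs_le.1 (hbd m₁ hf₁ hm₁C φ ψ)
    have h2 := abs_le.1 (hbd m₂ hf₂ hm₂C φ ψ)
    rw [abs_le]
    constructor <;> linarith [h1.1, h1.2, h2.1, h2.2]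

/-- A function of bounded variation has a measure as distributional gradient. -/
theorem exists_isDistribGradient {f : Eu N → ℝ} (hf : Integrable f (vol Ω)) {C : ℝ} (hC : 0 ≤ C)
    (hv : totalVariation Ω f ≤ ENNReal.ofReal C) :
    ∃ μ : Fin N → SignedMeasure Ω, IsDistribGradient Ω f μ ∧
      ∀ i (φ ψ : C₀(Ω, ℝ)),
        |signedIntegral (μ i) φ - signedIntegral (μ i) ψ| ≤ 2 * C * ‖φ - ψ‖ := by
  have : LocallyCompactSpace Ω := Ω.isOpen.locallyCompactSpace
  choose Λ hΛ hΛC using fun i => exists_dual_comp_eq (restrictZeroAtInfty Ω)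
    restrictZeroAtInfty_injective (distribDeriv hf i) hC (abs_distribDeriv_le hf hC hv i)
  choose μ hμ hμb using fun i => exists_signedMeasure_of_dual (Λ i) hC (hΛC i)
  refine ⟨μ, fun φ i => ?_, hμb⟩
  have h1 := hμ i _ (hasCompactSupport_restrictZeroAtInfty φ)
  rw [hΛ] at h1
  have h2 : distribDeriv hf i φ = -∫ x, f x * fderiv ℝ φ x (stdVec i) ∂(vol Ω) := rfl
  rw [← neg_eq_iff_eq_neg, ← h2]
  exact h1.symm

/-- Test functions are dense in `C₀(Ω)`. -/
theorem exists_testFunction_norm_sub_le (φ : C₀(Ω, ℝ)) {ε : ℝ} (hε : 0 < ε) :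
    ∃ g : 𝓓(Ω, ℝ), ‖φ - restrictZeroAtInfty Ω g‖ ≤ ε := by
  have hε2 : 0 < ε / 2 := by positivity
  -- Soft thresholding: `S` vanishes near zero and moves no value by more than `ε / 2`. As `φ`
  -- vanishes at infinity, `S ∘ φ` has compact support in `Ω`.
  let S : ℝ → ℝ := fun t => t - max (-(ε / 2)) (min t (ε / 2))
  have hS : Continuous S := by fun_prop
  have hS0 : ∀ t, |t| < ε / 2 → S t = 0 := by
    intro t ht
    rw [abs_lt] at ht
    simp only [S]
    rw [min_eq_left ht.2.le, max_eq_right ht.1.le, sub_self]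
  have hSt : ∀ t, |t - S t| ≤ ε / 2 := by
    intro t
    simp only [S, sub_sub_cancel]
    rw [abs_le]
    exact ⟨le_max_left _ _, max_le (by linarith) (min_le_right _ _)⟩
  let ψ : Ω → ℝ := fun x => S (φ x)
  have hψ : Continuous ψ := hS.comp φ.continuous
  have hψc : HasCompactSupport ψ := by
    have hev : ∀ᶠ x in cocompact Ω, |φ x| < ε / 2 := by
      have := φ.zero_at_infty'
      have h2 := this.eventually (Metric.ball_mem_nhds (0 : ℝ) hε2)
      filter_upwards [h2] with x hx
      simpa [Metric.mem_ball] using hx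
    obtain ⟨K, hK, hKs⟩ := mem_cocompact.1 hev
    exact HasCompactSupport.intro hK fun x hx => hS0 _ (hKs hx)
  let ψe : Eu N → ℝ := Function.extend Subtype.val ψ 0
  have hψe : Continuous ψe := hψc.continuous_extend_zero Ω.isOpen hψ
  -- The smooth approximation does not enlarge the support, so `g` stays supported in the compact `K
  -- ⊆ Ω`; it uses the other half of `ε`.
  obtain ⟨g, hg, hgd, hgs⟩ := hψe.exists_contDiff_approx ⊤ (ε := fun _ => ε / 2)
    continuous_const (fun _ => hε2)
  let K : Set (Eu N) := Subtype.val '' tsupport ψ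
  have hK : IsCompact K := hψc.isCompact.image continuous_subtype_val
  have hKΩ : K ⊆ Ω := by rintro _ ⟨x, -, rfl⟩; exact x.2
  have hsup : Function.support g ⊆ K := by
    refine hgs.trans fun x hx => ?_
    by_contra hxK
    refine hx ?_
    by_cases hxΩ : x ∈ Ω
    · have : ψe x = ψ ⟨x, hxΩ⟩ := Subtype.val_injective.extend_apply ψ 0 ⟨x, hxΩ⟩
      rw [this]
      exact image_eq_zero_of_notMem_tsupport fun h => hxK ⟨_, h, rfl⟩
    · exact Function.extend_apply' _ _ _ (by rintro ⟨a, rfl⟩; exact hxΩ a.2)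
  have hts : tsupport g ⊆ K := closure_minimal hsup hK.isClosed
  let G : 𝓓(Ω, ℝ) := ⟨g, hg, hK.of_isClosed_subset (isClosed_tsupport g) hts, hts.trans hKΩ⟩
  refine ⟨G, zeroAtInfty_norm_le hε.le fun x => ?_⟩
  change |φ x - g x| ≤ ε
  have h1 := hSt (φ x)
  have h2 := (hgd x).le
  have h3 : ψe x = S (φ x) := Subtype.val_injective.extend_apply ψ 0 x
  rw [h3, Real.dist_eq] at h2
  rw [abs_le] at *
  constructor <;> linarith [h1.1, h1.2, h2.1, h2.2]

theorem tendsto_integral_mul_of_tendsto_eLpNorm_one {α : Type*} [MeasurableSpace α] {μ : Measure α}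
    {f : ℕ → α → ℝ} {f₀ : α → ℝ} (hf : ∀ k, Integrable (f k) μ) (hf₀ : Integrable f₀ μ)
    (hlim : Tendsto (fun k => eLpNorm (fun x => f k x - f₀ x) 1 μ) atTop (𝓝 0))
    {g : α → ℝ} (hg : AEStronglyMeasurable g μ) {c : ℝ} (hb : ∀ x, |g x| ≤ c) :
    Tendsto (fun k => ∫ x, f k x * g x ∂μ) atTop (𝓝 (∫ x, f₀ x * g x ∂μ)) := by
  have hm : ∀ u : α → ℝ, Integrable u μ → Integrable (fun x => u x * g x) μ := fun u hu =>
    hu.mul_bdd hg (Eventually.of_forall hb)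
  refine tendsto_integral_of_L1 _ (hm f₀ hf₀).aestronglyMeasurable
    (Eventually.of_forall fun k => hm _ (hf k)) ?_
  have h1 : Tendsto (fun k => ENNReal.ofReal c * eLpNorm (fun x => f k x - f₀ x) 1 μ) atTop
      (𝓝 0) := by
    simpa using ENNReal.Tendsto.const_mul hlim (Or.inr ENNReal.ofReal_ne_top)
  refine tendsto_of_tendsto_of_tendsto_of_le_of_le tendsto_const_nhds h1 (fun _ => zero_le)
    fun k => ?_
  rw [eLpNorm_one_eq_lintegral_enorm, ← lintegral_const_mul' _ _ ENNReal.ofReal_ne_top]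
  refine lintegral_mono fun x => ?_
  simp only
  rw [← sub_mul, enorm_mul, mul_comm]
  gcongr
  rw [← ofReal_norm]
  exact ENNReal.ofReal_le_ofReal (hb x)

/-- Lower semicontinuity: the variation is a supremum of functionals, each of which passes to the
limit. -/
theorem totalVariation_le_of_tendsto {f : ℕ → Eu N → ℝ} {f₀ : Eu N → ℝ} {C : ℝ} (hC : 0 ≤ C)
    (hv : ∀ k, totalVariation Ω (f k) ≤ ENNReal.ofReal C)
    (hlim : ∀ ψ : 𝓓^{1}(Ω, Eu N), Tendsto (fun k => ∫ x, f k x * divergence ψ x ∂(vol Ω)) atTop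
      (𝓝 (∫ x, f₀ x * divergence ψ x ∂(vol Ω)))) :
    totalVariation Ω f₀ ≤ ENNReal.ofReal C := by
  refine iSup₂_le fun ψ hψ => ENNReal.ofReal_le_ofReal ?_
  refine le_of_tendsto (hlim ψ) (Eventually.of_forall fun k => ?_)
  rw [← ENNReal.ofReal_le_ofReal_iff hC]
  refine le_trans ?_ (hv k)
  exact le_iSup₂_of_le ψ hψ le_rfl

/-- Boundedness in `BV(Ω)` and convergence in `L¹(Ω)` imply weak convergence in `BV(Ω)`. -/
theorem bvWeakConv_of_tendsto {f : ℕ → Eu N → ℝ} {f₀ : Eu N → ℝ}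
    (hf : ∀ k, Integrable (f k) (vol Ω)) (hf₀ : Integrable f₀ (vol Ω)) {C : ℝ} (hC : 0 ≤ C)
    (hv : ∀ k, totalVariation Ω (f k) ≤ ENNReal.ofReal C)
    (hv₀ : totalVariation Ω f₀ ≤ ENNReal.ofReal C)
    (hlim : Tendsto (fun k => eLpNorm (fun x => f k x - f₀ x) 1 (vol Ω)) atTop (𝓝 0)) :
    BVWeakConv Ω f f₀ := by
  refine ⟨fun k => ⟨hf k, (hv k).trans_lt ENNReal.ofReal_lt_top⟩,
    ⟨hf₀, hv₀.trans_lt ENNReal.ofReal_lt_top⟩, hlim, ?_⟩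
  choose μ hμ hμb using fun k => exists_isDistribGradient (hf k) hC (hv k)
  obtain ⟨μ₀, hμ₀, hμ₀b⟩ := exists_isDistribGradient hf₀ hC hv₀
  refine ⟨μ, μ₀, hμ, hμ₀, fun φ i => ?_⟩
  -- On test functions the pairing with the measures is `-∫ f k ∂_i g`, so `L¹` convergence
  -- suffices. The Lipschitz constant `2 * C`, uniform in `k`, then carries the limit to all of
  -- `C₀(Ω)`.
  have htest : ∀ g : 𝓓(Ω, ℝ), Tendsto (fun k => signedIntegral (μ k i) (restrictZeroAtInfty Ω g))
      atTop (𝓝 (signedIntegral (μ₀ i) (restrictZeroAtInfty Ω g))) := by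
    intro g
    have hgd := contDiff_one_testFunction g
    have hcont : Continuous fun x => fderiv ℝ g x (stdVec i) :=
      (hgd.continuous_fderiv (by simp)).clm_apply continuous_const
    obtain ⟨c, hc⟩ := hcont.bounded_above_of_compact_support (g.hasCompactSupport.fderiv_apply ℝ _)
    have h1 := (tendsto_integral_mul_of_tendsto_eLpNorm_one hf hf₀ hlim
      hcont.aestronglyMeasurable hc).neg
    simp_rw [hμ _ g i, hμ₀ g i, neg_neg] at h1
    exact h1
  rw [Metric.tendsto_atTop]
  intro ε hε
  -- This accuracy makes `2 * C * ‖φ - g‖` at most `ε / 4`; the error occurs twice, for `μ k` and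
  -- for `μ₀`.
  obtain ⟨g, hg⟩ := exists_testFunction_norm_sub_le φ (ε := ε / (8 * (C + 1))) (by positivity)
  obtain ⟨n, hn⟩ := Metric.tendsto_atTop.1 (htest g) (ε / 2) (by positivity)
  refine ⟨n, fun k hk => ?_⟩
  have h1 := hμb k i φ (restrictZeroAtInfty Ω g)
  have h2 := hμ₀b i φ (restrictZeroAtInfty Ω g)
  have h3 := hn k hk
  have h4 : 2 * C * ‖φ - restrictZeroAtInfty Ω g‖ ≤ ε / 4 := by
    calc 2 * C * ‖φ - restrictZeroAtInfty Ω g‖ ≤ 2 * C * (ε / (8 * (C + 1))) := by gcongr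
      _ ≤ ε / 4 := by
        rw [mul_div_assoc', div_le_div_iff₀ (by positivity) (by positivity)]
        nlinarith
  have h1 := h1.trans h4
  have h2 := h2.trans h4
  rw [Real.dist_eq] at *
  rw [abs_le] at h1 h2
  rw [abs_lt] at *
  constructor <;> linarith [h1.1, h1.2, h2.1, h2.2, h3.1, h3.2]

end WeightedControl

/-! ### Strong `L¹` compactness from a variation bound -/

namespace WeightedControl
variable {N : ℕ} {Ω : Opens (Eu N)}

theorem tsupport_comp_sub_subset {φ : Eu N → ℝ} {K : Set (Eu N)} (hK : tsupport φ ⊆ K) {δ : ℝ}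
    {h : Eu N} (hh : ‖h‖ ≤ δ) : tsupport (fun x => φ (x - h)) ⊆ Metric.cthickening δ K := by
  refine closure_minimal (fun x hx => ?_) Metric.isClosed_cthickening
  have hx' : x - h ∈ K := hK (subset_tsupport φ hx)
  exact Metric.mem_cthickening_of_dist_le x (x - h) δ K hx' (by simpa [dist_eq_norm] using hh)

theorem hasCompactSupport_comp_sub {φ : Eu N → ℝ} (hφ : HasCompactSupport φ) (h : Eu N) :
    HasCompactSupport (fun x => φ (x - h)) :=
  hφ.comp_homeomorph (Homeomorph.subRight h)

/-- The translation estimate for functions of bounded variation, tested against `φ`. -/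
theorem abs_integral_mul_translate_sub_le {w : Eu N → ℝ} (hw : Integrable w (vol Ω)) {C : ℝ}
    (hC : 0 ≤ C) (hv : totalVariation Ω w ≤ ENNReal.ofReal C) {φ : Eu N → ℝ}
    (hφ : ContDiff ℝ 1 φ) (hc : HasCompactSupport φ) (hb : ∀ x, |φ x| ≤ 1) {δ : ℝ} (hδ : 0 < δ)
    (hs : Metric.cthickening δ (tsupport φ) ⊆ Ω) {h : Eu N} (hh : ‖h‖ ≤ δ) :
    |∫ x, w x * φ (x - h) ∂(vol Ω) - ∫ x, w x * φ x ∂(vol Ω)| ≤ C * δ := by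
  have hfc : Continuous (fderiv ℝ φ) := hφ.continuous_fderiv (by simp)
  obtain ⟨M, hM⟩ := hfc.bounded_above_of_compact_support (hc.fderiv ℝ)
  have hder : ∀ (x : Eu N) (t : ℝ),
      HasDerivAt (fun t : ℝ => φ (x - t • h)) (-(fderiv ℝ φ (x - t • h) h)) t := by
    intro x t
    have h1 : HasDerivAt (fun t : ℝ => x - t • h) (-h) t := by
      simpa using ((hasDerivAt_id t).smul_const h).const_sub x
    have h2 := (hφ.differentiable (by simp) (x - t • h)).hasFDerivAt.comp_hasDerivAt t h1
    simpa using! h2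
  -- Mean value inequality along the segment from `0` to `h`: each translate of `φ` is still
  -- supported in `Ω`, and `|φ| ‖h‖ ≤ δ`, so the variation bounds the derivative by `C * δ`.
  let F : ℝ → ℝ := fun t => ∫ x, w x * φ (x - t • h) ∂(vol Ω)
  let F' : ℝ → ℝ := fun t => ∫ x, w x * (-(fderiv ℝ φ (x - t • h) h)) ∂(vol Ω)
  have hF : ∀ t, HasDerivAt F (F' t) t := by
    intro t
    refine (hasDerivAt_integral_of_dominated_loc_of_deriv_le (μ := vol Ω)
      (F := fun t x => w x * φ (x - t • h))
      (F' := fun t x => w x * (-(fderiv ℝ φ (x - t • h) h)))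
      (bound := fun x => |w x| * (M * ‖h‖)) (s := Set.univ) (x₀ := t) univ_mem ?_ ?_ ?_ ?_ ?_ ?_).2
    · refine Eventually.of_forall fun s => hw.aestronglyMeasurable.mul ?_
      exact (hφ.continuous.comp (by fun_prop)).aestronglyMeasurable
    · exact integrable_mul_continuous_of_hasCompactSupport hw
        (hφ.continuous.comp (by fun_prop)) (hasCompactSupport_comp_sub hc _)
    · refine hw.aestronglyMeasurable.mul ?_
      exact ((hfc.comp (by fun_prop)).clm_apply continuous_const).neg.aestronglyMeasurable
    · refine Eventually.of_forall fun x s _ => ?_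
      rw [norm_mul, norm_neg, Real.norm_eq_abs]
      gcongr
      exact ((fderiv ℝ φ (x - s • h)).le_opNorm h).trans (by gcongr; exact hM _)
    · exact hw.abs.mul_const _
    · exact Eventually.of_forall fun x s _ => (hder x s).const_mul _
  have hbound : ∀ t ∈ Set.Ico (0 : ℝ) 1, ‖F' t‖ ≤ C * δ := by
    intro t ht
    have hth : ‖t • h‖ ≤ δ := by
      rw [norm_smul, Real.norm_eq_abs, abs_of_nonneg ht.1]
      nlinarith [ht.2, norm_nonneg h, ht.1]
    have h1 := abs_integral_mul_fderiv_le hC hv (φ := fun x => φ (x - t • h))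
      (hφ.comp (contDiff_id.sub contDiff_const)) (hasCompactSupport_comp_sub hc _)
      ((tsupport_comp_sub_subset subset_rfl hth).trans hs) h hδ (fun x => by
        nlinarith [hb (x - t • h), norm_nonneg h, abs_nonneg (φ (x - t • h))])
    simp_rw [fderiv_comp_sub] at h1
    simp only [F']
    simp_rw [mul_neg]
    rw [integral_neg, norm_neg]
    exact h1
  have := norm_image_sub_le_of_norm_deriv_le_segment_01' (f := F) (f' := F')
    (fun t _ => (hF t).hasDerivWithinAt) hbound
  simpa [F] using this

/-- The mollification `y ↦ ∫ w(x) η(x - y) dx` of a function on `Ω`. -/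
noncomputable def mollified (Ω : Opens (Eu N)) (w η : Eu N → ℝ) (y : Eu N) : ℝ :=
  ∫ x, w x * η (x - y) ∂(vol Ω)

theorem abs_mollified_le {w η : Eu N → ℝ} {M I : ℝ} (hw : Integrable w (vol Ω))
    (hM : ∀ x, |η x| ≤ M) (hI : ∫ x, |w x| ∂(vol Ω) ≤ I) (y : Eu N) :
    |mollified Ω w η y| ≤ I * M := by
  have hM0 : 0 ≤ M := (abs_nonneg _).trans (hM 0)
  calc |mollified Ω w η y| ≤ ∫ x, |w x| * M ∂(vol Ω) := by
        rw [← Real.norm_eq_abs]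
        refine norm_integral_le_of_norm_le (hw.abs.mul_const M) (Eventually.of_forall fun x => ?_)
        rw [norm_mul]
        exact mul_le_mul_of_nonneg_left (hM _) (abs_nonneg _)
    _ ≤ I * M := by rw [integral_mul_const]; gcongr

theorem aestronglyMeasurable_mollified {w η : Eu N → ℝ} (hw : Integrable w (vol Ω))
    (hη : Continuous η) (ν : Measure (Eu N)) [SFinite ν] :
    AEStronglyMeasurable (mollified Ω w η) ν := by
  have h : AEStronglyMeasurable (fun z : Eu N × Eu N => w z.2 * η (z.2 - z.1)) (ν.prod (vol Ω)) :=
    (hw.aestronglyMeasurable.comp_snd).mul (hη.comp (by fun_prop)).aestronglyMeasurable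
  exact h.integral_prod_right'

/-- Duality between translating the test function and mollifying `w`. -/
theorem integral_mul_integral_translate {w η φ : Eu N → ℝ} (hw : Integrable w (vol Ω))
    (hη : Continuous η) (hηi : Integrable η) (hηb : ∃ M, ∀ x, |η x| ≤ M) (hφ : Continuous φ)
    (hφi : Integrable φ) (hφb : ∀ x, |φ x| ≤ 1) :
    ∫ h, η h * ∫ x, w x * φ (x - h) ∂(vol Ω) = ∫ y, φ y * mollified Ω w η y := by
  obtain ⟨M, hM⟩ := hηb
  have h1 : ∀ x, ∫ h, η h * (w x * φ (x - h)) = ∫ y, φ y * (w x * η (x - y)) := by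
    intro x
    rw [← integral_sub_left_eq_self _ volume x]
    refine integral_congr_ae (Eventually.of_forall fun y => ?_)
    simp only [sub_sub_cancel]
    ring
  have i1 : Integrable (Function.uncurry fun h x => η h * (w x * φ (x - h)))
      ((volume : Measure (Eu N)).prod (vol Ω)) := by
    have := (hηi.mul_prod hw).mul_bdd (g := fun z : Eu N × Eu N => φ (z.2 - z.1))
      (hφ.comp (by fun_prop)).aestronglyMeasurable (Eventually.of_forall fun z => hφb _)
    refine this.congr (Eventually.of_forall fun z => ?_)
    simp only [Function.uncurry]
    ring
  have i2 : Integrable (Function.uncurry fun x y => φ y * (w x * η (x - y)))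
      ((vol Ω).prod (volume : Measure (Eu N))) := by
    have := (hw.mul_prod hφi).mul_bdd (g := fun z : Eu N × Eu N => η (z.1 - z.2))
      (hη.comp (by fun_prop)).aestronglyMeasurable (Eventually.of_forall fun z => hM _)
    refine this.congr (Eventually.of_forall fun z => ?_)
    simp only [Function.uncurry]
    ring
  simp_rw [mollified, ← integral_const_mul]
  rw [integral_integral_swap i1]
  simp_rw [h1]
  rw [integral_integral_swap i2]

/-- A function of bounded variation tested against `φ` is controlled by its mollification. -/
theorem abs_integral_mul_le_mollified (hΩ : Bornology.IsBounded (Ω : Set (Eu N)))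
    {w : Eu N → ℝ} (hw : Integrable w (vol Ω)) {C : ℝ}
    (hC : 0 ≤ C) (hv : totalVariation Ω w ≤ ENNReal.ofReal C) {φ : Eu N → ℝ}
    (hφ : ContDiff ℝ 1 φ) (hc : HasCompactSupport φ) (hb : ∀ x, |φ x| ≤ 1) {δ : ℝ} (hδ : 0 < δ)
    (hs : Metric.cthickening δ (tsupport φ) ⊆ Ω) (η : ContDiffBump (0 : Eu N))
    (hη : η.rOut ≤ δ) :
    |∫ x, w x * φ x ∂(vol Ω)| ≤ C * δ + ∫ y, |mollified Ω w (η.normed volume) y| ∂(vol Ω) := by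
  set g := η.normed (volume : Measure (Eu N))
  have hgc : Continuous g := η.continuous_normed
  have hgi : Integrable g := η.integrable_normed
  have hgb : ∃ M, ∀ x, |g x| ≤ M :=
    hgc.bounded_above_of_compact_support η.hasCompactSupport_normed
  have hφi : Integrable φ := hφ.continuous.integrable_of_hasCompactSupport hc
  have hdual := integral_mul_integral_translate hw hgc hgi hgb hφ.continuous hφi hb
  have hφΩ : ∀ x, x ∉ Ω → φ x = 0 := fun x hx => image_eq_zero_of_notMem_tsupport fun h =>
    hx (hs (Metric.self_subset_cthickening _ h))
  have hAb : ∀ h, ‖∫ x, w x * φ (x - h) ∂(vol Ω)‖ ≤ ∫ x, |w x| ∂(vol Ω) := by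
    intro h
    refine norm_integral_le_of_norm_le hw.abs (Eventually.of_forall fun x => ?_)
    rw [norm_mul]
    exact mul_le_of_le_one_right (abs_nonneg _) (hb _)
  have hAm : AEStronglyMeasurable (fun h => ∫ x, w x * φ (x - h) ∂(vol Ω)) volume :=
    aestronglyMeasurable_mollified hw hφ.continuous volume
  have hAi : Integrable (fun h => g h * ∫ x, w x * φ (x - h) ∂(vol Ω)) :=
    hgi.mul_bdd hAm (Eventually.of_forall hAb)
  -- Since `g` is a probability density supported in the ball of radius `δ`, replacing `φ` by the
  -- average of its translates costs at most `C * δ`; by duality that average falls on `w` as a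
  -- mollification.
  have hfirst : |(∫ h, g h * ∫ x, w x * φ (x - h) ∂(vol Ω)) - ∫ x, w x * φ x ∂(vol Ω)|
      ≤ C * δ := by
    have e : (∫ h, g h * ∫ x, w x * φ (x - h) ∂(vol Ω)) - ∫ x, w x * φ x ∂(vol Ω)
        = ∫ h, g h * (∫ x, w x * φ (x - h) ∂(vol Ω) - ∫ x, w x * φ x ∂(vol Ω)) := by
      simp_rw [mul_sub]
      rw [integral_sub hAi (hgi.mul_const _), integral_mul_const, η.integral_normed, one_mul]
    rw [e]
    have e2 : C * δ = ∫ h, g h * (C * δ) := by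
      rw [integral_mul_const, η.integral_normed, one_mul]
    rw [e2, ← Real.norm_eq_abs]
    refine norm_integral_le_of_norm_le (hgi.mul_const _) (Eventually.of_forall fun h => ?_)
    rw [norm_mul, Real.norm_of_nonneg (η.nonneg_normed h)]
    by_cases hh : ‖h‖ ≤ δ
    · exact mul_le_mul_of_nonneg_left
        (abs_integral_mul_translate_sub_le hw hC hv hφ hc hb hδ hs hh) (η.nonneg_normed h)
    · have : η.normed volume h = 0 := by
        by_contra hne
        have hmem : h ∈ Function.support g := hne
        rw [η.support_normed_eq, Metric.mem_ball, dist_zero_right] at hmem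
        exact hh (hmem.le.trans hη)
      rw [this, zero_mul]
      exact mul_nonneg (η.nonneg_normed h) (by positivity)
  have hsecond : |∫ y, φ y * mollified Ω w g y| ≤ ∫ y, |mollified Ω w g y| ∂(vol Ω) := by
    have e : ∫ y, φ y * mollified Ω w g y = ∫ y, φ y * mollified Ω w g y ∂(vol Ω) := by
      refine (setIntegral_eq_integral_of_forall_compl_eq_zero fun y hy => ?_).symm
      rw [hφΩ y hy, zero_mul]
    rw [e]
    obtain ⟨M, hM⟩ := hgb
    have : IsFiniteMeasure (vol Ω) := ⟨by simpa using hΩ.measure_lt_top⟩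
    rw [← Real.norm_eq_abs]
    refine norm_integral_le_of_norm_le ?_ (Eventually.of_forall fun y => ?_)
    · exact (Integrable.of_bound (aestronglyMeasurable_mollified hw hgc (vol Ω)) _
        (Eventually.of_forall (abs_mollified_le hw hM le_rfl))).abs
    · rw [norm_mul]
      exact mul_le_of_le_one_left (abs_nonneg _) (hb y)
  rw [hdual] at hfirst
  rw [abs_le] at *
  constructor <;> linarith [hfirst.1, hfirst.2, hsecond.1, hsecond.2]

/-- Approximation of the `L¹` norm on a compact set by smooth test functions. -/
theorem exists_seq_testFunction_tendsto_integral_abs {w : Eu N → ℝ} (hw : Integrable w (vol Ω))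
    {K : Set (Eu N)} (hK : IsCompact K) {δ : ℝ} (hδ : 0 < δ) :
    ∃ φ : ℕ → Eu N → ℝ, (∀ n, ContDiff ℝ 1 (φ n) ∧ HasCompactSupport (φ n) ∧
      (∀ x, |φ n x| ≤ 1) ∧ tsupport (φ n) ⊆ Metric.cthickening δ K) ∧
      Tendsto (fun n => ∫ x, w x * φ n x ∂(vol Ω)) atTop (𝓝 (∫ x in K, |w x| ∂(vol Ω))) := by
  classical
  -- A measurable representative makes the sign function measurable; `s` is the sign of `w` on `K`,
  -- and its mollifications are the test functions sought.
  let w' := hw.aestronglyMeasurable.mk w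
  have hw' : Measurable w' := hw.aestronglyMeasurable.stronglyMeasurable_mk.measurable
  let s : Eu N → ℝ := K.indicator fun x => if 0 ≤ w' x then 1 else -1
  have hsm : Measurable s :=
    (Measurable.ite (measurableSet_le measurable_const hw') measurable_const
      measurable_const).indicator hK.measurableSet
  have hs1 : ∀ x, |s x| ≤ 1 := by
    intro x
    by_cases hx : x ∈ K
    · simp only [s, Set.indicator_of_mem hx]; split_ifs <;> simp
    · simp [s, Set.indicator_of_notMem hx]
  have hsK : ∀ x, x ∉ K → s x = 0 := fun x hx => Set.indicator_of_notMem hx _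
  have hsi : Integrable s := by
    have : IntegrableOn s K := by
      have : IsFiniteMeasure (volume.restrict K) := ⟨by simpa using hK.measure_lt_top⟩
      exact Integrable.of_bound hsm.aestronglyMeasurable 1 (Eventually.of_forall hs1)
    exact (integrableOn_iff_integrable_of_support_subset fun x hx => by
      by_contra hxK; exact hx (hsK x hxK)).1 this
  -- The inner radius is half the outer one: a bounded ratio (here `2`) is needed for a.e.
  -- convergence of the mollifications by Lebesgue differentiation.
  let β : ℕ → ContDiffBump (0 : Eu N) := fun n =>
    ⟨δ / (n + 1) / 2, δ / (n + 1), by positivity, half_lt_self (by positivity)⟩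
  have hβout : ∀ n, (β n).rOut = δ / (n + 1) := fun n => rfl
  have hβle : ∀ n, (β n).rOut ≤ δ := fun n => by
    rw [hβout]
    exact div_le_self hδ.le (by simp)
  have hβ0 : Tendsto (fun n => (β n).rOut) atTop (𝓝 0) := by
    simp_rw [hβout]
    have := (tendsto_one_div_add_atTop_nhds_zero_nat (𝕜 := ℝ)).const_mul δ
    simpa [div_eq_mul_inv] using this
  let φ : ℕ → Eu N → ℝ := fun n =>
    convolution ((β n).normed volume) s (ContinuousLinearMap.lsmul ℝ ℝ) volume
  have hφ1 : ∀ n x, |φ n x| ≤ 1 := by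
    intro n x
    rw [← (β n).integral_normed (μ := volume), ← Real.norm_eq_abs]
    refine norm_integral_le_of_norm_le (β n).integrable_normed (Eventually.of_forall fun t => ?_)
    simp only [ContinuousLinearMap.lsmul_apply, smul_eq_mul, norm_mul]
    rw [Real.norm_of_nonneg ((β n).nonneg_normed t)]
    exact mul_le_of_le_one_right ((β n).nonneg_normed t) (hs1 _)
  have hφd : ∀ n, ContDiff ℝ 1 (φ n) := fun n =>
    (β n).hasCompactSupport_normed.contDiff_convolution_left _ (β n).contDiff_normed
      hsi.locallyIntegrable
  have hφs : ∀ n, tsupport (φ n) ⊆ Metric.cthickening δ K := by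
    intro n
    refine closure_minimal ?_ Metric.isClosed_cthickening
    refine (support_convolution_subset (L := ContinuousLinearMap.lsmul ℝ ℝ)
      (f := (β n).normed volume) (g := s) (μ := volume)).trans ?_
    rintro _ ⟨a, ha, b, hb, rfl⟩
    rw [(β n).support_normed_eq, Metric.mem_ball, dist_zero_right] at ha
    have hbK : b ∈ K := by by_contra hbK; exact hb (hsK b hbK)
    refine Metric.mem_cthickening_of_dist_le _ b δ K hbK ?_
    simpa [dist_eq_norm] using ha.le.trans (hβle n)
  refine ⟨φ, fun n => ⟨hφd n, ?_, hφ1 n, hφs n⟩, ?_⟩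
  · exact hK.cthickening.of_isClosed_subset (isClosed_tsupport _) (hφs n)
  have hae : ∀ᵐ x ∂(vol Ω), Tendsto (fun n => φ n x) atTop (𝓝 (s x)) :=
    ae_restrict_of_ae (ContDiffBump.ae_convolution_tendsto_right_of_locallyIntegrable (K := 2) hβ0
      (Eventually.of_forall fun n => by simp [β]; linarith) hsi.locallyIntegrable)
  have hend : ∫ x in K, |w x| ∂(vol Ω) = ∫ x, w x * s x ∂(vol Ω) := by
    rw [← integral_indicator hK.measurableSet]
    refine integral_congr_ae ?_
    filter_upwards [hw.aestronglyMeasurable.ae_eq_mk] with x hx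
    by_cases hxK : x ∈ K
    · simp only [s, Set.indicator_of_mem hxK]
      change w x = w' x at hx
      rw [hx]
      split_ifs with h0
      · rw [abs_of_nonneg h0, mul_one]
      · rw [abs_of_neg (not_le.1 h0)]; ring
    · simp [s, Set.indicator_of_notMem hxK]
  rw [hend]
  refine tendsto_integral_of_dominated_convergence (fun x => |w x|)
    (fun n => hw.aestronglyMeasurable.mul (hφd n).continuous.aestronglyMeasurable) hw.abs
    (fun n => Eventually.of_forall fun x => ?_) ?_
  · rw [norm_mul]
    exact mul_le_of_le_one_right (abs_nonneg _) (hφ1 n x)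
  · filter_upwards [hae] with x hx
    exact hx.const_mul _

/-- Test with mollified signs of `w` on `K`. The room `δ + δ` around `K` is spent once on smoothing
the sign and once on translating the test function. -/
theorem setIntegral_abs_le_mollified (hΩ : Bornology.IsBounded (Ω : Set (Eu N)))
    {w : Eu N → ℝ} (hw : Integrable w (vol Ω)) {C : ℝ}
    (hC : 0 ≤ C) (hv : totalVariation Ω w ≤ ENNReal.ofReal C) {K : Set (Eu N)} (hK : IsCompact K)
    {δ : ℝ} (hδ : 0 < δ) (hs : Metric.cthickening (δ + δ) K ⊆ Ω) (η : ContDiffBump (0 : Eu N))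
    (hη : η.rOut ≤ δ) :
    ∫ x in K, |w x| ∂(vol Ω) ≤ C * δ + ∫ y, |mollified Ω w (η.normed volume) y| ∂(vol Ω) := by
  obtain ⟨φ, hφ, hlim⟩ := exists_seq_testFunction_tendsto_integral_abs hw hK hδ
  refine le_of_tendsto hlim (Eventually.of_forall fun n => ?_)
  obtain ⟨h1, h2, h3, h4⟩ := hφ n
  refine (le_abs_self _).trans (abs_integral_mul_le_mollified hΩ hw hC hv h1 h2 h3 hδ ?_ η hη)
  refine ((Metric.cthickening_subset_of_subset δ h4).trans ?_).trans hs
  exact Metric.cthickening_cthickening_subset hδ.le hδ.le K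

/-- An integrable function on `Ω` has small integral off a compact subset of `Ω`. -/
theorem exists_isCompact_setIntegral_compl_lt {G : Eu N → ℝ} (hG : Integrable G (vol Ω))
    (hG0 : ∀ᵐ x ∂(vol Ω), 0 ≤ G x) {ε : ℝ} (hε : 0 < ε) :
    ∃ K ⊆ (Ω : Set (Eu N)), IsCompact K ∧ ∫ x in Kᶜ, G x ∂(vol Ω) < ε := by
  -- Inner regularity of the finite measure `G dx` on the open set `Ω` provides `K`.
  let ν : Measure (Eu N) := (vol Ω).withDensity fun x => ENNReal.ofReal (G x)
  have hν : IsFiniteMeasure ν := isFiniteMeasure_withDensity_ofReal hG.2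
  obtain ⟨K, hKΩ, hK, hlt⟩ := Ω.isOpen.measurableSet.exists_isCompact_sdiff_lt (μ := ν)
    (measure_ne_top ν _) (ε := ENNReal.ofReal ε) (by simpa using hε)
  refine ⟨K, hKΩ, hK, ?_⟩
  have h1 : ENNReal.ofReal (∫ x in Kᶜ, G x ∂(vol Ω)) = ν (Ω \ K) := by
    rw [ofReal_integral_eq_lintegral_ofReal hG.integrableOn (ae_restrict_of_ae hG0),
      withDensity_apply _ (Ω.isOpen.measurableSet.diff hK.measurableSet)]
    rw [Measure.restrict_restrict hK.measurableSet.compl,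
      Measure.restrict_restrict (Ω.isOpen.measurableSet.diff hK.measurableSet)]
    congr 2
    ext x
    simp only [Set.mem_inter_iff, Set.mem_compl_iff, Set.mem_sdiff]
    tauto
  rw [← h1] at hlt
  exact (ENNReal.ofReal_lt_ofReal_iff hε).1 hlt

/-- Weak convergence, domination and a variation bound give strong convergence in `L¹(Ω)`. -/
theorem tendsto_integral_abs_of_weak (hΩ : Bornology.IsBounded (Ω : Set (Eu N)))
    {w : ℕ → Eu N → ℝ} {G : Eu N → ℝ} (hw : ∀ k, Integrable (w k) (vol Ω))
    (hG : Integrable G (vol Ω)) (hwG : ∀ k, ∀ᵐ x ∂(vol Ω), |w k x| ≤ G x) {C : ℝ} (hC : 0 ≤ C)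
    (hv : ∀ k, totalVariation Ω (w k) ≤ ENNReal.ofReal C)
    (hweak : ∀ g : Eu N → ℝ, Continuous g → (∃ M, ∀ x, |g x| ≤ M) →
      Tendsto (fun k => ∫ x, w k x * g x ∂(vol Ω)) atTop (𝓝 0)) :
    Tendsto (fun k => ∫ x, |w k x| ∂(vol Ω)) atTop (𝓝 0) := by
  have hfin : IsFiniteMeasure (vol Ω) := ⟨by simpa using hΩ.measure_lt_top⟩
  have hG0 : ∀ᵐ x ∂(vol Ω), 0 ≤ G x := (hwG 0).mono fun x hx => (abs_nonneg _).trans hx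
  rw [Metric.tendsto_atTop]
  intro ε hε
  obtain ⟨K, hKΩ, hK, hKG⟩ := exists_isCompact_setIntegral_compl_lt hG hG0 (ε := ε / 3)
    (by positivity)
  obtain ⟨δ₀, hδ₀, hδ₀s⟩ := hK.exists_cthickening_subset_open Ω.isOpen hKΩ
  -- The first entry leaves room for two thickenings by `δ`; the second makes the variation error `C
  -- * δ` at most `ε / 3`. The other two thirds cover the mass of `G` off `K` and the mollified
  -- term.
  set δ := min (δ₀ / 2) (ε / (3 * (C + 1)))
  have hδ : 0 < δ := by positivity
  have hCδ : C * δ ≤ ε / 3 := by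
    calc C * δ ≤ C * (ε / (3 * (C + 1))) := by gcongr; exact min_le_right _ _
      _ ≤ ε / 3 := by
        rw [mul_div_assoc', div_le_div_iff₀ (by positivity) (by positivity)]
        nlinarith
  have hs : Metric.cthickening (δ + δ) K ⊆ Ω := by
    refine (Metric.cthickening_mono ?_ K).trans hδ₀s
    linarith [min_le_left (δ₀ / 2) (ε / (3 * (C + 1)))]
  let η : ContDiffBump (0 : Eu N) := ⟨δ / 2, δ, by positivity, half_lt_self hδ⟩
  have hgc : Continuous (η.normed (volume : Measure (Eu N))) := η.continuous_normed
  obtain ⟨M, hM⟩ := hgc.bounded_above_of_compact_support η.hasCompactSupport_normed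
  have hmol : Tendsto (fun k => ∫ y, |mollified Ω (w k) (η.normed volume) y| ∂(vol Ω)) atTop
      (𝓝 0) := by
    have h0 : (0 : ℝ) = ∫ _ : Eu N, (0 : ℝ) ∂(vol Ω) := by simp
    rw [h0]
    -- At each `y` the mollification is a pairing with the continuous bounded function `η(· - y)`,
    -- so it tends to zero; it is bounded by `M ∫ G`, integrable as `Ω` is bounded.
    refine tendsto_integral_of_dominated_convergence (fun _ => (∫ x, G x ∂(vol Ω)) * M)
      (fun k => (aestronglyMeasurable_mollified (hw k) hgc _).norm) (integrable_const _)
      (fun k => Eventually.of_forall fun y => ?_) (Eventually.of_forall fun y => ?_)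
    · rw [Real.norm_eq_abs, abs_abs]
      exact abs_mollified_le (hw k) hM (integral_mono_ae (hw k).abs hG (hwG k)) y
    · have := (hweak (fun x => η.normed volume (x - y)) (hgc.comp (by fun_prop))
        ⟨M, fun x => hM _⟩).abs
      simpa [mollified] using this
  obtain ⟨n, hn⟩ := Metric.tendsto_atTop.1 hmol (ε / 3) (by positivity)
  refine ⟨n, fun k hk => ?_⟩
  have h1 := hn k hk
  rw [Real.dist_eq, sub_zero] at h1 ⊢
  have h2 := setIntegral_abs_le_mollified hΩ (hw k) hC (hv k) hK hδ hs η le_rfl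
  have h3 : ∫ x in Kᶜ, |w k x| ∂(vol Ω) ≤ ∫ x in Kᶜ, G x ∂(vol Ω) :=
    integral_mono_ae (hw k).abs.integrableOn hG.integrableOn (ae_restrict_of_ae (hwG k))
  have h4 := integral_add_compl hK.measurableSet (hw k).abs
  rw [abs_of_nonneg (integral_nonneg fun x => abs_nonneg _)] at h1 ⊢
  linarith

theorem continuous_divergence (ψ : 𝓓^{1}(Ω, Eu N)) : Continuous (divergence ψ) := by
  have h : Continuous (fderiv ℝ ψ) :=
    ContDiff.continuous_fderiv (n := 1) ψ.contDiff (by simp)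
  unfold divergence
  fun_prop

theorem exists_abs_divergence_le (ψ : 𝓓^{1}(Ω, Eu N)) : ∃ c, ∀ x, |divergence ψ x| ≤ c := by
  refine (continuous_divergence ψ).bounded_above_of_compact_support ?_
  refine HasCompactSupport.intro (ψ.hasCompactSupport.fderiv ℝ).isCompact fun x hx => ?_
  simp [divergence, image_eq_zero_of_notMem_tsupport hx]

theorem divergence_neg (ψ : 𝓓^{1}(Ω, Eu N)) (x : Eu N) :
    divergence (-ψ : 𝓓^{1}(Ω, Eu N)) x = -divergence ψ x := by
  have h : fderiv ℝ (-ψ : 𝓓^{1}(Ω, Eu N)) x = -fderiv ℝ ψ x := fderiv_neg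
  unfold divergence
  rw [h]
  simp

theorem integral_mul_divergence_le {f : Eu N → ℝ} {C : ℝ} (hC : 0 ≤ C)
    (hf : totalVariation Ω f ≤ ENNReal.ofReal C) {ψ : 𝓓^{1}(Ω, Eu N)} (hψ : ∀ x, ‖ψ x‖ ≤ 1) :
    ∫ x, f x * divergence ψ x ∂(vol Ω) ≤ C := by
  rw [← ENNReal.ofReal_le_ofReal_iff hC]
  exact le_trans (le_iSup₂_of_le ψ hψ le_rfl) hf

theorem integrable_mul_divergence {f : Eu N → ℝ} (hf : Integrable f (vol Ω))
    (ψ : 𝓓^{1}(Ω, Eu N)) : Integrable (fun x => f x * divergence ψ x) (vol Ω) := by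
  obtain ⟨c, hc⟩ := exists_abs_divergence_le ψ
  exact hf.mul_bdd (continuous_divergence ψ).aestronglyMeasurable (Eventually.of_forall hc)

theorem totalVariation_sub_le {f g : Eu N → ℝ} (hf : Integrable f (vol Ω))
    (hg : Integrable g (vol Ω)) {C : ℝ} (hC : 0 ≤ C)
    (hfC : totalVariation Ω f ≤ ENNReal.ofReal C) (hgC : totalVariation Ω g ≤ ENNReal.ofReal C) :
    totalVariation Ω (fun x => f x - g x) ≤ ENNReal.ofReal (C + C) := by
  refine iSup₂_le fun ψ hψ => ENNReal.ofReal_le_ofReal ?_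
  have h1 := integral_mul_divergence_le hC hfC hψ
  have h2 := integral_mul_divergence_le hC hgC (ψ := -ψ) fun x => by
    change ‖-ψ x‖ ≤ 1
    rw [norm_neg]
    exact hψ x
  simp_rw [divergence_neg, mul_neg, integral_neg] at h2
  simp_rw [sub_mul]
  rw [integral_sub (integrable_mul_divergence hf ψ) (integrable_mul_divergence hg ψ)]
  linarith

end WeightedControl

/-! ### Weak closedness of the space with zero trace on `Γ_D` -/

/-- Closed subspaces of a Hilbert space are weakly sequentially closed. -/
theorem Submodule.mem_of_tendsto_inner {H : Type*} [NormedAddCommGroup H] [InnerProductSpace ℝ H]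
    [CompleteSpace H] {T : Submodule ℝ H} (hT : IsClosed (T : Set H)) {z : ℕ → H} {z₀ : H}
    (hz : ∀ n, z n ∈ T)
    (hlim : ∀ w, Tendsto (fun n => inner ℝ (z n) w) atTop (𝓝 (inner ℝ z₀ w))) : z₀ ∈ T := by
  have : CompleteSpace T := hT.completeSpace_coe
  rw [← Submodule.orthogonal_orthogonal T, Submodule.mem_orthogonal']
  intro w hw
  have h : ∀ n, inner ℝ (z n) w = 0 := fun n => (Submodule.mem_orthogonal T w).1 hw _ (hz n)
  have h2 := hlim w
  simp_rw [h] at h2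
  exact tendsto_nhds_unique h2 tendsto_const_nhds

namespace WeightedControl
variable {N : ℕ} {Ω : Opens (Eu N)} {ΓD : Set (Eu N)}

theorem MemW11.isWeakGradient {y : Eu N → ℝ} (hy : MemW11 Ω y) :
    IsWeakGradient Ω y (weakGradient Ω y) := by
  unfold weakGradient
  rw [dif_pos hy.2]
  exact hy.2.choose_spec

/-- Weak gradients are unique almost everywhere. -/
theorem IsWeakGradient.ae_eq {y : Eu N → ℝ} {G₁ G₂ : Eu N → Eu N} (h₁ : IsWeakGradient Ω y G₁)
    (h₂ : IsWeakGradient Ω y G₂) : G₁ =ᵐ[vol Ω] G₂ := by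
  have hi : ∀ {G : Eu N → Eu N}, Integrable G (vol Ω) → ∀ i, Integrable (fun x => G x i) (vol Ω) :=
    fun hG i => (EuclideanSpace.proj (𝕜 := ℝ) i).integrable_comp hG
  have key : ∀ i : Fin N, ∀ᵐ x ∂(vol Ω), G₁ x i - G₂ x i = 0 := by
    intro i
    have hd := (hi h₁.1 i).sub (hi h₂.1 i)
    rw [ae_restrict_iff' Ω.isOpen.measurableSet]
    refine Ω.isOpen.ae_eq_zero_of_integral_contDiff_smul_eq_zero (f := fun x => G₁ x i - G₂ x i)
      (IntegrableOn.locallyIntegrableOn hd) fun g hg hgc hgs => ?_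
    let φ : 𝓓(Ω, ℝ) := ⟨g, hg, hgc, hgs⟩
    have e1 := h₁.2 φ i
    rw [h₂.2 φ i, neg_inj] at e1
    have e2 : ∫ x, g x • (G₁ x i - G₂ x i) = ∫ x, g x • (G₁ x i - G₂ x i) ∂(vol Ω) := by
      refine (setIntegral_eq_integral_of_forall_compl_eq_zero fun x hx => ?_).symm
      rw [show g x = 0 from testFunction_apply_eq_zero φ hx, zero_smul]
    rw [e2]
    have e3 : ∀ x, g x • (G₁ x i - G₂ x i) = G₁ x i * φ x - G₂ x i * φ x := fun x => by
      change g x * _ = _ * g x - _ * g x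
      ring
    simp_rw [e3]
    rw [integral_sub
      (integrable_mul_continuous_of_hasCompactSupport (hi h₁.1 i) φ.continuous φ.hasCompactSupport)
      (integrable_mul_continuous_of_hasCompactSupport (hi h₂.1 i) φ.continuous φ.hasCompactSupport),
      e1, sub_self]
  filter_upwards [ae_all_iff.2 key] with x hx
  ext i
  exact sub_eq_zero.1 (hx i)

/-- The pair `(y, v)` is a limit in `L¹(Ω)` of pairs `(φ, ∇φ)` with `φ ∈ C_0^∞(ℝ^N; Γ_D)`. -/
def IsGradientLimit (Ω : Opens (Eu N)) (ΓD : Set (Eu N)) (y : Eu N → ℝ) (v : Eu N → Eu N) : Prop :=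
  ∀ ε : ℝ≥0∞, 0 < ε → ∃ φ : 𝓓((⊤ : Opens (Eu N)), ℝ), VanishesOn ΓD φ ∧
      eLpNorm (fun x => y x - φ x) 1 (vol Ω)
        + eLpNorm (fun x => v x - gradient φ x) 1 (vol Ω) < ε

theorem continuous_gradient_testFunction (φ : 𝓓((⊤ : Opens (Eu N)), ℝ)) :
    Continuous (gradient φ) :=
  (InnerProductSpace.toDual ℝ (Eu N)).symm.continuous.comp
    ((contDiff_one_testFunction φ).continuous_fderiv (by simp))

theorem gradient_add_testFunction (φ ψ : 𝓓((⊤ : Opens (Eu N)), ℝ)) (x : Eu N) :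
    gradient (φ + ψ : 𝓓((⊤ : Opens (Eu N)), ℝ)) x = gradient φ x + gradient ψ x := by
  have h : fderiv ℝ (φ + ψ : 𝓓((⊤ : Opens (Eu N)), ℝ)) x = fderiv ℝ φ x + fderiv ℝ ψ x :=
    fderiv_add ((contDiff_one_testFunction φ).differentiable (by simp) x)
      ((contDiff_one_testFunction ψ).differentiable (by simp) x)
  unfold gradient
  rw [h, map_add]

theorem gradient_smul_testFunction (c : ℝ) (φ : 𝓓((⊤ : Opens (Eu N)), ℝ)) (x : Eu N) :
    gradient (c • φ : 𝓓((⊤ : Opens (Eu N)), ℝ)) x = c • gradient φ x := by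
  have h : fderiv ℝ (c • φ : 𝓓((⊤ : Opens (Eu N)), ℝ)) x = c • fderiv ℝ φ x :=
    fderiv_const_smul ((contDiff_one_testFunction φ).differentiable (by simp) x) c
  unfold gradient
  rw [h]
  simp

namespace IsGradientLimit
variable {y y' : Eu N → ℝ} {v v' : Eu N → Eu N}

theorem congr_ae (h : IsGradientLimit Ω ΓD y v) (hy : y =ᵐ[vol Ω] y') (hv : v =ᵐ[vol Ω] v') :
    IsGradientLimit Ω ΓD y' v' := by
  intro ε hε
  obtain ⟨φ, hφ, hlt⟩ := h ε hε
  refine ⟨φ, hφ, ?_⟩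
  rwa [← eLpNorm_congr_ae (show (fun x => y x - φ x) =ᵐ[vol Ω] _ from
      hy.mono fun x hx => by simp only [hx]),
    ← eLpNorm_congr_ae (show (fun x => v x - gradient φ x) =ᵐ[vol Ω] _ from
      hv.mono fun x hx => by simp only [hx])]

/-- A limit of gradient limits is a gradient limit. -/
theorem of_forall_exists (hy : AEStronglyMeasurable y (vol Ω)) (hv : AEStronglyMeasurable v (vol Ω))
    (h : ∀ ε : ℝ≥0∞, 0 < ε → ∃ (y' : Eu N → ℝ) (v' : Eu N → Eu N),
      AEStronglyMeasurable y' (vol Ω) ∧ AEStronglyMeasurable v' (vol Ω) ∧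
      IsGradientLimit Ω ΓD y' v' ∧
      eLpNorm (y - y') 1 (vol Ω) + eLpNorm (v - v') 1 (vol Ω) < ε) :
    IsGradientLimit Ω ΓD y v := by
  intro ε hε
  have hε2 : 0 < ε / 2 := ENNReal.half_pos hε.ne'
  obtain ⟨y', v', hy', hv', hlim, hlt⟩ := h (ε / 2) hε2
  obtain ⟨φ, hφ, hφlt⟩ := hlim (ε / 2) hε2
  refine ⟨φ, hφ, ?_⟩
  have h1 : eLpNorm (fun x => y x - φ x) 1 (vol Ω)
      ≤ eLpNorm (y - y') 1 (vol Ω) + eLpNorm (fun x => y' x - φ x) 1 (vol Ω) := by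
    have := eLpNorm_add_le (hy.sub hy') (hy'.sub φ.continuous.aestronglyMeasurable) le_rfl
    rwa [sub_add_sub_cancel] at this
  have h2 : eLpNorm (fun x => v x - gradient φ x) 1 (vol Ω)
      ≤ eLpNorm (v - v') 1 (vol Ω) + eLpNorm (fun x => v' x - gradient φ x) 1 (vol Ω) := by
    have := eLpNorm_add_le (hv.sub hv')
      (hv'.sub (continuous_gradient_testFunction φ).aestronglyMeasurable) le_rfl
    rwa [sub_add_sub_cancel] at this
  calc _ ≤ (eLpNorm (y - y') 1 (vol Ω) + eLpNorm (fun x => y' x - φ x) 1 (vol Ω))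
        + (eLpNorm (v - v') 1 (vol Ω) + eLpNorm (fun x => v' x - gradient φ x) 1 (vol Ω)) :=
        add_le_add h1 h2
    _ = (eLpNorm (y - y') 1 (vol Ω) + eLpNorm (v - v') 1 (vol Ω))
        + (eLpNorm (fun x => y' x - φ x) 1 (vol Ω)
          + eLpNorm (fun x => v' x - gradient φ x) 1 (vol Ω)) := by ring
    _ < ε / 2 + ε / 2 := ENNReal.add_lt_add hlt hφlt
    _ = ε := ENNReal.add_halves ε

theorem zero : IsGradientLimit Ω ΓD (0 : Eu N → ℝ) (0 : Eu N → Eu N) := by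
  intro ε hε
  refine ⟨0, fun x _ => rfl, ?_⟩
  have h : ∀ x, gradient (0 : 𝓓((⊤ : Opens (Eu N)), ℝ)) x = 0 := fun x => by
    have := gradient_smul_testFunction 0 (0 : 𝓓((⊤ : Opens (Eu N)), ℝ)) x
    rwa [zero_smul, zero_smul] at this
  simp_rw [h]
  simpa using hε

theorem add (hy : AEStronglyMeasurable y (vol Ω)) (hv : AEStronglyMeasurable v (vol Ω))
    (hy' : AEStronglyMeasurable y' (vol Ω)) (hv' : AEStronglyMeasurable v' (vol Ω))
    (h : IsGradientLimit Ω ΓD y v) (h' : IsGradientLimit Ω ΓD y' v') :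
    IsGradientLimit Ω ΓD (y + y') (v + v') := by
  intro ε hε
  have hε2 : 0 < ε / 2 := ENNReal.half_pos hε.ne'
  obtain ⟨φ, hφ, hφlt⟩ := h (ε / 2) hε2
  obtain ⟨ψ, hψ, hψlt⟩ := h' (ε / 2) hε2
  refine ⟨φ + ψ, fun x hx => ?_, ?_⟩
  · change φ x + ψ x = 0
    rw [hφ x hx, hψ x hx, add_zero]
  have h1 : eLpNorm (fun x => (y + y') x - (φ + ψ : 𝓓((⊤ : Opens (Eu N)), ℝ)) x) 1 (vol Ω)
      ≤ eLpNorm (fun x => y x - φ x) 1 (vol Ω) + eLpNorm (fun x => y' x - ψ x) 1 (vol Ω) := by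
    refine le_trans (le_of_eq (congrArg (fun u => eLpNorm u 1 (vol Ω)) ?_))
      (eLpNorm_add_le (hy.sub φ.continuous.aestronglyMeasurable)
        (hy'.sub ψ.continuous.aestronglyMeasurable) le_rfl)
    funext x
    change y x + y' x - (φ x + ψ x) = y x - φ x + (y' x - ψ x)
    ring
  have h2 : eLpNorm (fun x => (v + v') x - gradient (φ + ψ : 𝓓((⊤ : Opens (Eu N)), ℝ)) x) 1 (vol Ω)
      ≤ eLpNorm (fun x => v x - gradient φ x) 1 (vol Ω)
        + eLpNorm (fun x => v' x - gradient ψ x) 1 (vol Ω) := by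
    refine le_trans (le_of_eq (congrArg (fun u => eLpNorm u 1 (vol Ω)) ?_))
      (eLpNorm_add_le (hv.sub (continuous_gradient_testFunction φ).aestronglyMeasurable)
        (hv'.sub (continuous_gradient_testFunction ψ).aestronglyMeasurable) le_rfl)
    funext x
    rw [gradient_add_testFunction]
    simp only [Pi.add_apply]
    abel
  calc _ ≤ _ := add_le_add h1 h2
    _ = (eLpNorm (fun x => y x - φ x) 1 (vol Ω) + eLpNorm (fun x => v x - gradient φ x) 1 (vol Ω))
        + (eLpNorm (fun x => y' x - ψ x) 1 (vol Ω)
          + eLpNorm (fun x => v' x - gradient ψ x) 1 (vol Ω)) := by ring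
    _ < ε / 2 + ε / 2 := ENNReal.add_lt_add hφlt hψlt
    _ = ε := ENNReal.add_halves ε

theorem const_smul (h : IsGradientLimit Ω ΓD y v) (c : ℝ) :
    IsGradientLimit Ω ΓD (c • y) (c • v) := by
  rcases eq_or_ne c 0 with rfl | hc
  · simpa using zero (Ω := Ω) (ΓD := ΓD)
  intro ε hε
  have hc0 : ‖c‖ₑ ≠ 0 := by simpa using hc
  obtain ⟨φ, hφ, hlt⟩ := h (ε / ‖c‖ₑ) (ENNReal.div_pos hε.ne' (by simp))
  refine ⟨c • φ, fun x hx => ?_, ?_⟩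
  · change c * φ x = 0
    rw [hφ x hx, mul_zero]
  have h1 : (fun x => (c • y) x - (c • φ : 𝓓((⊤ : Opens (Eu N)), ℝ)) x)
      = c • fun x => y x - φ x := by
    funext x
    change c * y x - c * φ x = c * (y x - φ x)
    ring
  have h2 : (fun x => (c • v) x - gradient (c • φ : 𝓓((⊤ : Opens (Eu N)), ℝ)) x)
      = c • fun x => v x - gradient φ x := by
    funext x
    rw [gradient_smul_testFunction]
    simp [smul_sub]
  rw [h1, h2, eLpNorm_const_smul, eLpNorm_const_smul, ← mul_add]
  rwa [ENNReal.lt_div_iff_mul_lt (Or.inl hc0) (Or.inl (by simp)), mul_comm] at hlt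

end IsGradientLimit

/-- Pairs `(y, u)` of `L²` functions such that `(y, c u)` is a gradient limit. -/
noncomputable def gradientLimitSubmodule (Ω : Opens (Eu N)) (ΓD : Set (Eu N)) (c : Eu N → ℝ)
    (hc : AEStronglyMeasurable c (vol Ω)) :
    Submodule ℝ (WithLp 2 (Lp ℝ 2 (vol Ω) × Lp (Eu N) 2 (vol Ω))) where
  carrier := {z | IsGradientLimit Ω ΓD z.fst (c • (z.snd : Eu N → Eu N))}
  zero_mem' := by
    refine IsGradientLimit.zero.congr_ae (Lp.coeFn_zero ℝ 2 (vol Ω)).symm ?_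
    filter_upwards [Lp.coeFn_zero (Eu N) 2 (vol Ω)] with x hx
    simp only [WithLp.zero_snd, Pi.smul_apply', hx]
    simp
  add_mem' {z z'} hz hz' := by
    refine (IsGradientLimit.add (Lp.aestronglyMeasurable _) (hc.smul (Lp.aestronglyMeasurable _))
      (Lp.aestronglyMeasurable _) (hc.smul (Lp.aestronglyMeasurable _)) hz hz').congr_ae
      (Lp.coeFn_add z.fst z'.fst).symm ?_
    filter_upwards [Lp.coeFn_add z.snd z'.snd] with x hx
    simp only [WithLp.add_snd, Pi.smul_apply', Pi.add_apply, hx, smul_add]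
  smul_mem' a z hz := by
    refine (IsGradientLimit.const_smul hz a).congr_ae (Lp.coeFn_smul a z.fst).symm ?_
    filter_upwards [Lp.coeFn_smul a z.snd] with x hx
    simp only [WithLp.smul_snd, Pi.smul_apply', Pi.smul_apply, hx]
    rw [smul_comm]

/-- By Cauchy–Schwarz, the inclusion (multiplication by `1`) and multiplication by `c ∈ L²` are
continuous from `L²` to `L¹`, and gradient limits are closed in `L¹ × L¹`. -/
theorem isClosed_gradientLimitSubmodule [IsFiniteMeasure (vol Ω)] {c : Eu N → ℝ}
    (hc : MemLp c 2 (vol Ω)) :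
    IsClosed (gradientLimitSubmodule Ω ΓD c hc.1 :
      Set (WithLp 2 (Lp ℝ 2 (vol Ω) × Lp (Eu N) 2 (vol Ω)))) := by
  rw [← closure_subset_iff_isClosed]
  intro z hz
  obtain ⟨u, hu, hlim⟩ := mem_closure_iff_seq_limit.1 hz
  have h1 := ((WithLp.continuous_fst _ _ _).tendsto z).comp hlim
  have h2 := ((WithLp.continuous_snd _ _ _).tendsto z).comp hlim
  rw [Lp.tendsto_Lp_iff_tendsto_eLpNorm'] at h1 h2
  have k1 := ENNReal.Tendsto.const_mul (a := eLpNorm (1 : Eu N → ℝ) 2 (vol Ω)) h1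
    (Or.inr (memLp_const (1 : ℝ)).eLpNorm_ne_top)
  have k2 := ENNReal.Tendsto.const_mul (a := eLpNorm c 2 (vol Ω)) h2
    (Or.inr hc.eLpNorm_ne_top)
  have k := k1.add k2
  rw [mul_zero, mul_zero, add_zero] at k
  refine IsGradientLimit.of_forall_exists (Lp.aestronglyMeasurable _)
    (hc.1.smul (Lp.aestronglyMeasurable _)) fun ε hε => ?_
  obtain ⟨n, hn⟩ := (k.eventually_lt_const hε).exists
  refine ⟨_, _, Lp.aestronglyMeasurable _, hc.1.smul (Lp.aestronglyMeasurable _), hu n,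
    lt_of_le_of_lt (add_le_add ?_ ?_) hn⟩
  · have := eLpNorm_smul_le_mul_eLpNorm (p := 2) (q := 2) (r := 1) (μ := vol Ω)
      ((Lp.aestronglyMeasurable (u n).fst).sub (Lp.aestronglyMeasurable z.fst))
      (aestronglyMeasurable_const (b := (1 : ℝ)))
    rw [eLpNorm_sub_comm]
    refine le_trans (le_of_eq ?_) this
    congr 1
    funext x
    simp
  · have := eLpNorm_smul_le_mul_eLpNorm (p := 2) (q := 2) (r := 1) (μ := vol Ω)
      ((Lp.aestronglyMeasurable (u n).snd).sub (Lp.aestronglyMeasurable z.snd)) hc.1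
    rw [eLpNorm_sub_comm, ← smul_sub]
    exact this

/-- Gradient limits are stable under weak `L²` convergence of `y` and of the rescaled gradient. -/
theorem IsGradientLimit.of_weak [IsFiniteMeasure (vol Ω)] {b : Eu N → ℝ}
    (hb0 : ∀ᵐ x ∂(vol Ω), 0 < b x) (hb : MemLp (fun x => (b x)⁻¹) 2 (vol Ω))
    {y : ℕ → Eu N → ℝ} {y₀ : Eu N → ℝ} {v : ℕ → Eu N → Eu N} {v₀ : Eu N → Eu N}
    (hy : ∀ n, MemLp (y n) 2 (vol Ω)) (hy₀ : MemLp y₀ 2 (vol Ω))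
    (hv : ∀ n, MemLp (fun x => b x • v n x) 2 (vol Ω))
    (hv₀ : MemLp (fun x => b x • v₀ x) 2 (vol Ω))
    (hyw : ∀ g, MemLp g 2 (vol Ω) → Tendsto (fun n => ∫ x, inner ℝ (y n x) (g x) ∂(vol Ω)) atTop
        (𝓝 (∫ x, inner ℝ (y₀ x) (g x) ∂(vol Ω))))
    (hvw : ∀ g, MemLp g 2 (vol Ω) → Tendsto (fun n => ∫ x, inner ℝ (b x • v n x) (g x) ∂(vol Ω))
        atTop (𝓝 (∫ x, inner ℝ (b x • v₀ x) (g x) ∂(vol Ω))))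
    (h : ∀ n, IsGradientLimit Ω ΓD (y n) (v n)) : IsGradientLimit Ω ΓD y₀ v₀ := by
  have hcan : ∀ {u : Eu N → Eu N} (hu : MemLp (fun x => b x • u x) 2 (vol Ω)),
      ((fun x => (b x)⁻¹) • (hu.toLp _ : Eu N → Eu N)) =ᵐ[vol Ω] u := by
    intro u hu
    filter_upwards [hu.coeFn_toLp, hb0] with x hx hx0
    rw [Pi.smul_apply', hx, smul_smul, inv_mul_cancel₀ hx0.ne', one_smul]
  let Z : ∀ {a : Eu N → ℝ} {u : Eu N → Eu N}, MemLp a 2 (vol Ω) →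
      MemLp (fun x => b x • u x) 2 (vol Ω) →
      WithLp 2 (Lp ℝ 2 (vol Ω) × Lp (Eu N) 2 (vol Ω)) :=
    fun ha hu => WithLp.toLp 2 (ha.toLp _, hu.toLp _)
  -- With `c = 1 / b`, the pair `(y, b v)` lies in the submodule exactly when `(y, v)` is a gradient
  -- limit; the two weak limits together are weak convergence in the product Hilbert space.
  have hmem : Z hy₀ hv₀ ∈ gradientLimitSubmodule Ω ΓD _ hb.1 := by
    refine Submodule.mem_of_tendsto_inner (isClosed_gradientLimitSubmodule hb)
      (z := fun n => Z (hy n) (hv n)) (fun n => ?_) fun w => ?_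
    · exact (h n).congr_ae (hy n).coeFn_toLp.symm (hcan (hv n)).symm
    · have e : ∀ {a : Eu N → ℝ} {u : Eu N → Eu N} (ha : MemLp a 2 (vol Ω))
          (hu : MemLp (fun x => b x • u x) 2 (vol Ω)), inner ℝ (Z ha hu) w
          = ∫ x, inner ℝ (a x) (w.fst x) ∂(vol Ω)
            + ∫ x, inner ℝ (b x • u x) (w.snd x) ∂(vol Ω) := by
        intro a u ha hu
        rw [WithLp.prod_inner_apply, integral_inner_eq_inner_toLp ha (Lp.memLp w.fst),
          integral_inner_eq_inner_toLp hu (Lp.memLp w.snd), Lp.toLp_coeFn, Lp.toLp_coeFn]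
        rfl
      simp_rw [e]
      exact (hyw _ (Lp.memLp w.fst)).add (hvw _ (Lp.memLp w.snd))
  exact IsGradientLimit.congr_ae hmem hy₀.coeFn_toLp (hcan hv₀)

end WeightedControl

/-! ### Weighted measures and passage to the limit -/

theorem memLp_two_sqrt {α : Type*} [MeasurableSpace α] {μ : Measure α} {f : α → ℝ}
    (hf : Integrable f μ) : MemLp (fun x => √(f x)) 2 μ := by
  have hm : AEStronglyMeasurable (fun x => √(f x)) μ :=
    Real.continuous_sqrt.comp_aestronglyMeasurable hf.1
  rw [memLp_two_iff_integrable_sq hm]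
  refine hf.mono (hm.pow 2) (Eventually.of_forall fun x => ?_)
  rw [Real.norm_of_nonneg (sq_nonneg _)]
  rcases le_total 0 (f x) with h | h
  · rw [Real.sq_sqrt h]; exact le_abs_self _
  · rw [Real.sqrt_eq_zero_of_nonpos h]; simp

theorem lintegral_enorm_sq_eq_eLpNorm_sq {α E : Type*} [MeasurableSpace α] [NormedAddCommGroup E]
    {μ : Measure α} (f : α → E) : ∫⁻ x, ‖f x‖ₑ ^ 2 ∂μ = eLpNorm f 2 μ ^ 2 := by
  rw [eLpNorm_eq_lintegral_rpow_enorm_toReal (by simp) (by simp)]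
  simp only [ENNReal.toReal_ofNat, ENNReal.rpow_ofNat]
  rw [← ENNReal.rpow_natCast, ← ENNReal.rpow_mul]
  norm_num

namespace WeightedControl
variable {N : ℕ} {Ω : Opens (Eu N)} {ΓD : Set (Eu N)}

/-- Multiplication by `√r` maps `L²(r dx)` isometrically into the fixed space `L²(dx)`. Where `r ≤
0`, both `√r` and `ENNReal.ofReal r` vanish, so no sign condition is needed. -/
theorem eLpNorm_sqrt_smul {r : Eu N → ℝ} {v : Eu N → Eu N} (hr : AEMeasurable r (vol Ω))
    (hv : AEStronglyMeasurable v (vol Ω)) :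
    eLpNorm (fun x => √(r x) • v x) 2 (vol Ω) = eLpNorm v 2 (weightedMeasure Ω r) := by
  have h : ∫⁻ x, ‖√(r x) • v x‖ₑ ^ 2 ∂(vol Ω) = ∫⁻ x, ‖v x‖ₑ ^ 2 ∂(weightedMeasure Ω r) := by
    rw [weightedMeasure, lintegral_withDensity_eq_lintegral_mul₀ hr.ennreal_ofReal
      (hv.enorm.pow_const 2)]
    refine lintegral_congr fun x => ?_
    rw [Pi.mul_apply, enorm_smul, mul_pow]
    congr 1
    rw [Real.enorm_eq_ofReal (Real.sqrt_nonneg _), ← ENNReal.ofReal_pow (Real.sqrt_nonneg _)]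
    rcases le_total 0 (r x) with h0 | h0
    · rw [Real.sq_sqrt h0]
    · rw [Real.sqrt_eq_zero_of_nonpos h0, ENNReal.ofReal_of_nonpos h0]; simp
  rw [eLpNorm_eq_lintegral_rpow_enorm_toReal (by simp) (by simp),
    eLpNorm_eq_lintegral_rpow_enorm_toReal (by simp) (by simp)]
  simp only [ENNReal.toReal_ofNat, ENNReal.rpow_ofNat]
  rw [h]

theorem integral_weightedMeasure {r : Eu N → ℝ} (hr : AEMeasurable r (vol Ω))
    (hr0 : ∀ᵐ x ∂(vol Ω), 0 < r x) (F : Eu N → Eu N) :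
    ∫ x, F x ∂(weightedMeasure Ω r) = ∫ x, r x • F x ∂(vol Ω) := by
  rw [weightedMeasure, integral_withDensity_eq_integral_toReal_smul₀ hr.ennreal_ofReal
    (Eventually.of_forall fun x => ENNReal.ofReal_lt_top)]
  refine integral_congr_ae ?_
  filter_upwards [hr0] with x hx
  rw [ENNReal.toReal_ofReal hx.le]

/-- Sequences of functions between `0` and an integrable function are weakly relatively compact
in `L¹(Ω)`. -/
theorem exists_subseq_weak_of_dominated {r : ℕ → Eu N → ℝ} {ξ : Eu N → ℝ}
    (hξ : Integrable ξ (vol Ω)) (hξ0 : ∀ᵐ x ∂(vol Ω), 0 < ξ x)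
    (hr : ∀ k, Integrable (r k) (vol Ω)) (hr0 : ∀ k, ∀ᵐ x ∂(vol Ω), 0 ≤ r k x)
    (hrξ : ∀ k, ∀ᵐ x ∂(vol Ω), r k x ≤ ξ x) :
    ∃ (r₀ : Eu N → ℝ) (σ : ℕ → ℕ), StrictMono σ ∧ Integrable r₀ (vol Ω) ∧
      ∀ g : Eu N → ℝ, AEStronglyMeasurable g (vol Ω) → (∃ M, ∀ x, |g x| ≤ M) →
        Tendsto (fun k => ∫ x, r (σ k) x * g x ∂(vol Ω)) atTop (𝓝 (∫ x, r₀ x * g x ∂(vol Ω))) := by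
  have hs := memLp_two_sqrt hξ
  -- The quotient is dominated by `√ξ`, hence bounded in `L²`, and `r k * g` is its product with the
  -- fixed `L²` function `√ξ * g`.
  let a : ℕ → Eu N → ℝ := fun k x => r k x / √(ξ x)
  have ham : ∀ k, AEStronglyMeasurable (a k) (vol Ω) := fun k =>
    ((hr k).1.aemeasurable.div hs.1.aemeasurable).aestronglyMeasurable
  have hale : ∀ k, ∀ᵐ x ∂(vol Ω), ‖a k x‖ ≤ ‖√(ξ x)‖ := by
    intro k
    filter_upwards [hξ0, hr0 k, hrξ k] with x h1 h2 h3
    rw [Real.norm_of_nonneg (div_nonneg h2 (Real.sqrt_nonneg _)),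
      Real.norm_of_nonneg (Real.sqrt_nonneg _), div_le_iff₀ (Real.sqrt_pos.2 h1),
      Real.mul_self_sqrt h1.le]
    exact h3
  have ha : ∀ k, MemLp (a k) 2 (vol Ω) := fun k => hs.mono (ham k) (hale k)
  obtain ⟨a₀, σ, hσ, ha₀, hlim⟩ := exists_subseq_tendsto_integral_inner ha hs.eLpNorm_ne_top
    fun k => eLpNorm_mono_ae (hale k)
  refine ⟨fun x => a₀ x * √(ξ x), σ, hσ, ha₀.integrable_mul hs, fun g hg hb => ?_⟩
  obtain ⟨M, hM⟩ := hb
  have hsg : MemLp (fun x => √(ξ x) * g x) 2 (vol Ω) := by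
    refine (hs.const_mul M).mono (hs.1.mul hg) (Eventually.of_forall fun x => ?_)
    rw [norm_mul, norm_mul, mul_comm]
    gcongr
    exact (hM x).trans (le_abs_self M)
  have h := hlim _ hsg
  have e1 : ∀ k, ∫ x, inner ℝ (a k x) (√(ξ x) * g x) ∂(vol Ω) = ∫ x, r k x * g x ∂(vol Ω) := by
    intro k
    refine integral_congr_ae ?_
    filter_upwards [hξ0] with x hx
    have : √(ξ x) ≠ 0 := (Real.sqrt_pos.2 hx).ne'
    change √(ξ x) * g x * (r k x / √(ξ x)) = _
    field_simp
  have e2 : ∫ x, inner ℝ (a₀ x) (√(ξ x) * g x) ∂(vol Ω)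
      = ∫ x, a₀ x * √(ξ x) * g x ∂(vol Ω) := by
    refine integral_congr_ae (Eventually.of_forall fun x => ?_)
    change √(ξ x) * g x * a₀ x = a₀ x * √(ξ x) * g x
    ring
  rw [e2] at h
  exact h.congr fun k => e1 (σ k)

/-- Compactness in `L¹(Ω)` of dominated sequences with bounded variation. -/
theorem exists_subseq_tendsto_of_variation (hΩ : Bornology.IsBounded (Ω : Set (Eu N)))
    {r : ℕ → Eu N → ℝ} {ξ : Eu N → ℝ}
    (hξ : Integrable ξ (vol Ω)) (hξ0 : ∀ᵐ x ∂(vol Ω), 0 < ξ x)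
    (hr : ∀ k, Integrable (r k) (vol Ω)) (hr0 : ∀ k, ∀ᵐ x ∂(vol Ω), 0 ≤ r k x)
    (hrξ : ∀ k, ∀ᵐ x ∂(vol Ω), r k x ≤ ξ x) {C : ℝ} (hC : 0 ≤ C)
    (hv : ∀ k, totalVariation Ω (r k) ≤ ENNReal.ofReal C) :
    ∃ (r₀ : Eu N → ℝ) (σ : ℕ → ℕ), StrictMono σ ∧ Integrable r₀ (vol Ω) ∧
      totalVariation Ω r₀ ≤ ENNReal.ofReal C ∧
      Tendsto (fun k => eLpNorm (fun x => r (σ k) x - r₀ x) 1 (vol Ω)) atTop (𝓝 0) ∧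
      ∀ᵐ x ∂(vol Ω), Tendsto (fun k => r (σ k) x) atTop (𝓝 (r₀ x)) := by
  obtain ⟨r₀, σ, hσ, hr₀, hweak⟩ := exists_subseq_weak_of_dominated hξ hξ0 hr hr0 hrξ
  have hv₀ : totalVariation Ω r₀ ≤ ENNReal.ofReal C :=
    totalVariation_le_of_tendsto hC (fun k => hv (σ k)) fun ψ =>
      hweak _ (continuous_divergence ψ).aestronglyMeasurable (exists_abs_divergence_le ψ)
  have hmul : ∀ {f g : Eu N → ℝ}, Integrable f (vol Ω) → Continuous g → (∃ M, ∀ x, |g x| ≤ M) →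
      Integrable (fun x => f x * g x) (vol Ω) := fun hf hg ⟨M, hM⟩ =>
    hf.mul_bdd hg.aestronglyMeasurable (Eventually.of_forall hM)
  have h_int := tendsto_integral_abs_of_weak hΩ (w := fun k x => r (σ k) x - r₀ x)
    (G := fun x => ξ x + |r₀ x|) (fun k => (hr (σ k)).sub hr₀) (hξ.add hr₀.abs)
    (fun k => by
      filter_upwards [hr0 (σ k), hrξ (σ k)] with x h1 h2
      refine (abs_sub _ _).trans ?_
      rw [abs_of_nonneg h1]
      linarith) (add_nonneg hC hC)
    (fun k => totalVariation_sub_le (hr (σ k)) hr₀ hC (hv (σ k)) hv₀)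
    (fun g hg hb => by
      have := (hweak g hg.aestronglyMeasurable hb).sub_const (∫ x, r₀ x * g x ∂(vol Ω))
      rw [sub_self] at this
      refine this.congr fun k => ?_
      simp_rw [sub_mul]
      rw [integral_sub (hmul (hr (σ k)) hg hb) (hmul hr₀ hg hb)])
  have hL1 : Tendsto (fun k => eLpNorm (fun x => r (σ k) x - r₀ x) 1 (vol Ω)) atTop (𝓝 0) := by
    have := ENNReal.tendsto_ofReal h_int
    rw [ENNReal.ofReal_zero] at this
    refine this.congr fun k => ?_
    rw [eLpNorm_one_eq_lintegral_enorm]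
    exact ofReal_integral_norm_eq_lintegral_enorm ((hr (σ k)).sub hr₀)
  obtain ⟨τ, hτ, hae⟩ := (tendstoInMeasure_of_tendsto_eLpNorm (p := 1) one_ne_zero
    (fun k => (hr (σ k)).1) hr₀.1 hL1).exists_seq_tendsto_ae
  exact ⟨r₀, σ ∘ τ, hσ.comp hτ, hr₀, hv₀, hL1.comp hτ.tendsto_atTop, hae⟩

/-- The passage to the limit in the weighted gradients. -/
theorem tendsto_weighted_gradients (hΩ : Bornology.IsBounded (Ω : Set (Eu N)))
    {ξ₁ ξ₂ : Eu N → ℝ} (hξ₂ : Integrable ξ₂ (vol Ω)) (hξ₁m : AEStronglyMeasurable ξ₁ (vol Ω))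
    (hξ₁pos : ∀ᵐ x ∂(vol Ω), 0 < ξ₁ x) (hξ₁inv : Integrable (fun x => (ξ₁ x)⁻¹) (vol Ω))
    {r : ℕ → Eu N → ℝ} {r₀ : Eu N → ℝ} (hr : ∀ k, Integrable (r k) (vol Ω))
    (hr₀ : Integrable r₀ (vol Ω)) (hrξ : ∀ k, ∀ᵐ x ∂(vol Ω), ξ₁ x ≤ r k x ∧ r k x ≤ ξ₂ x)
    (hr₀ξ : ∀ᵐ x ∂(vol Ω), ξ₁ x ≤ r₀ x ∧ r₀ x ≤ ξ₂ x)
    (hae : ∀ᵐ x ∂(vol Ω), Tendsto (fun k => r k x) atTop (𝓝 (r₀ x)))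
    {y : ℕ → Eu N → ℝ} {y₀ : Eu N → ℝ} (hy : ∀ k, MemLp (y k) 2 (vol Ω))
    (hy₀ : MemLp y₀ 2 (vol Ω)) (hyD : ∀ k, MemW11D Ω ΓD (y k))
    (hyw : ∀ g, MemLp g 2 (vol Ω) → Tendsto (fun k => ∫ x, inner ℝ (y k x) (g x) ∂(vol Ω)) atTop
        (𝓝 (∫ x, inner ℝ (y₀ x) (g x) ∂(vol Ω))))
    {B : ℝ≥0∞} (hB : B ≠ ⊤)
    (hvB : ∀ k, eLpNorm (weakGradient Ω (y k)) 2 (weightedMeasure Ω (r k)) ≤ B)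
    {u₀ : Eu N → Eu N} (hu₀ : MemLp u₀ 2 (vol Ω))
    (huw : ∀ g, MemLp g 2 (vol Ω) → Tendsto
      (fun k => ∫ x, inner ℝ (√(r k x) • weakGradient Ω (y k) x) (g x) ∂(vol Ω)) atTop
        (𝓝 (∫ x, inner ℝ (u₀ x) (g x) ∂(vol Ω)))) :
    MemWρ Ω ΓD r₀ y₀ ∧ ∀ φ : 𝓓(Ω, ℝ),
      Tendsto (fun k => ∫ x, φ x • weakGradient Ω (y k) x ∂(weightedMeasure Ω (r k))) atTop
        (𝓝 (∫ x, φ x • weakGradient Ω y₀ x ∂(weightedMeasure Ω r₀))) := by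
  have hfin : IsFiniteMeasure (vol Ω) := ⟨by simpa using hΩ.measure_lt_top⟩
  have hgrad : ∀ k, IsWeakGradient Ω (y k) (weakGradient Ω (y k)) := fun k =>
    (hyD k).1.isWeakGradient
  let v : ℕ → Eu N → Eu N := fun k => weakGradient Ω (y k)
  have hvm : ∀ k, AEStronglyMeasurable (v k) (vol Ω) := fun k => (hgrad k).1.1
  let u : ℕ → Eu N → Eu N := fun k x => √(r k x) • v k x
  have hsm : ∀ k, MemLp (fun x => √(r k x)) 2 (vol Ω) := fun k => memLp_two_sqrt (hr k)
  have huB : ∀ k, eLpNorm (u k) 2 (vol Ω) ≤ B := fun k =>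
    (eLpNorm_sqrt_smul (hr k).1.aemeasurable (hvm k)).trans_le (hvB k)
  have hu : ∀ k, MemLp (u k) 2 (vol Ω) := fun k =>
    ⟨(hsm k).1.smul (hvm k), (huB k).trans_lt hB.lt_top⟩
  have hpos : ∀ k, ∀ᵐ x ∂(vol Ω), 0 < r k x := fun k => by
    filter_upwards [hξ₁pos, hrξ k] with x h1 h2 using h1.trans_le h2.1
  have hpos₀ : ∀ᵐ x ∂(vol Ω), 0 < r₀ x := by
    filter_upwards [hξ₁pos, hr₀ξ] with x h1 h2 using h1.trans_le h2.1
  have hsqlim : ∀ᵐ x ∂(vol Ω), Tendsto (fun k => √(r k x)) atTop (𝓝 √(r₀ x)) := by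
    filter_upwards [hae] with x hx
    exact (Real.continuous_sqrt.tendsto _).comp hx
  have hinvlim : ∀ᵐ x ∂(vol Ω), Tendsto (fun k => (√(r k x))⁻¹) atTop (𝓝 (√(r₀ x))⁻¹) := by
    filter_upwards [hsqlim, hpos₀] with x hx h0
    exact hx.inv₀ (Real.sqrt_pos.2 h0).ne'
  have hinv₁ : MemLp (fun x => (√(ξ₁ x))⁻¹) 2 (vol Ω) := by
    have := memLp_two_sqrt hξ₁inv
    simpa [Real.sqrt_inv] using this
  have hinvle : ∀ {s : Eu N → ℝ}, (∀ᵐ x ∂(vol Ω), ξ₁ x ≤ s x ∧ s x ≤ ξ₂ x) →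
      ∀ᵐ x ∂(vol Ω), ‖(√(s x))⁻¹‖ ≤ (√(ξ₁ x))⁻¹ := by
    intro s hs
    filter_upwards [hs, hξ₁pos] with x h1 h2
    rw [Real.norm_of_nonneg (by positivity)]
    exact inv_anti₀ (Real.sqrt_pos.2 h2) (Real.sqrt_le_sqrt h1.1)
  have hinvm : ∀ {s : Eu N → ℝ}, Integrable s (vol Ω) →
      AEStronglyMeasurable (fun x => (√(s x))⁻¹) (vol Ω) := fun hs =>
    (memLp_two_sqrt hs).1.aemeasurable.inv.aestronglyMeasurable
  -- The candidate for `∇y₀`; it is integrable as a product of two `L²` functions.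
  let v₀ : Eu N → Eu N := fun x => (√(r₀ x))⁻¹ • u₀ x
  have hinv₀ : MemLp (fun x => (√(r₀ x))⁻¹) 2 (vol Ω) :=
    hinv₁.mono' (hinvm hr₀) (hinvle hr₀ξ)
  have hv₀i : Integrable v₀ (vol Ω) := by
    rw [← memLp_one_iff_integrable]
    exact hu₀.smul hinv₀
  have huv₀ : (fun x => √(r₀ x) • v₀ x) =ᵐ[vol Ω] u₀ := by
    filter_upwards [hpos₀] with x hx
    simp only [v₀]
    rw [smul_smul, mul_inv_cancel₀ (Real.sqrt_pos.2 hx).ne', one_smul]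
  have pair : ∀ {g : ℕ → Eu N → Eu N} {g₀ : Eu N → Eu N} {G : Eu N → ℝ}, MemLp G 2 (vol Ω) →
      (∀ n, AEStronglyMeasurable (g n) (vol Ω)) → (∀ n, ∀ᵐ x ∂(vol Ω), ‖g n x‖ ≤ G x) →
      (∀ᵐ x ∂(vol Ω), Tendsto (fun n => g n x) atTop (𝓝 (g₀ x))) →
      Tendsto (fun n => ∫ x, inner ℝ (u n x) (g n x) ∂(vol Ω)) atTop
        (𝓝 (∫ x, inner ℝ (u₀ x) (g₀ x) ∂(vol Ω))) := fun hG hg hle hlim =>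
    tendsto_integral_inner_of_weak_of_dominated hu hB huB huw hG hg hle hlim
  have hφb : ∀ φ : 𝓓(Ω, ℝ), ∃ M, ∀ x, |φ x| ≤ M := fun φ =>
    φ.continuous.bounded_above_of_compact_support φ.hasCompactSupport
  -- the limit `v₀` is the weak gradient of `y₀`
  have hwg : IsWeakGradient Ω y₀ v₀ := by
    refine ⟨hv₀i, fun φ i => ?_⟩
    obtain ⟨M, hM⟩ := hφb φ
    have hd : Continuous fun x => fderiv ℝ φ x (stdVec i) :=
      ((contDiff_one_testFunction φ).continuous_fderiv (by simp)).clm_apply continuous_const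
    have hdL : MemLp (fun x => fderiv ℝ φ x (stdVec i)) 2 (vol Ω) :=
      hd.memLp_of_hasCompactSupport (φ.hasCompactSupport.fderiv_apply ℝ _)
    have l1 := hyw _ hdL
    -- The factor `1 / √(r k)` cancels the one in `u k`, leaving `∫ v k i * φ`; domination comes
    -- from `1 / √ξ₁`.
    have l2 := pair (g := fun k x => ((√(r k x))⁻¹ * φ x) • stdVec i)
      (g₀ := fun x => ((√(r₀ x))⁻¹ * φ x) • stdVec i) (hinv₁.mul_const M)
      (fun k => ((hinvm (hr k)).mul φ.continuous.aestronglyMeasurable).smul_const _)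
      (fun k => by
        filter_upwards [hinvle (hrξ k)] with x hx
        rw [norm_smul, norm_mul]
        simp only [stdVec, PiLp.norm_single, norm_one, mul_one]
        exact mul_le_mul hx (hM x) (norm_nonneg _) ((norm_nonneg _).trans hx))
      (by
        filter_upwards [hinvlim] with x hx
        exact (hx.mul_const _).smul_const _)
    have e1 : ∀ k, ∫ x, inner ℝ (u k x) (((√(r k x))⁻¹ * φ x) • stdVec i) ∂(vol Ω)
        = ∫ x, v k x i * φ x ∂(vol Ω) := by
      intro k
      refine integral_congr_ae ?_
      filter_upwards [hpos k] with x hx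
      have h0 : √(r k x) ≠ 0 := (Real.sqrt_pos.2 hx).ne'
      simp only [u, stdVec, inner_smul_left, inner_smul_right, EuclideanSpace.inner_single_right]
      simp
      field_simp
    have e2 : ∫ x, inner ℝ (u₀ x) (((√(r₀ x))⁻¹ * φ x) • stdVec i) ∂(vol Ω)
        = ∫ x, v₀ x i * φ x ∂(vol Ω) := by
      refine integral_congr_ae (Eventually.of_forall fun x => ?_)
      simp only [v₀, stdVec, inner_smul_right, EuclideanSpace.inner_single_right]
      simp
      ring
    simp_rw [e1] at l2
    rw [e2] at l2
    have e3 : ∀ f : Eu N → ℝ, ∫ x, inner ℝ (f x) (fderiv ℝ φ x (stdVec i)) ∂(vol Ω)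
        = ∫ x, f x * fderiv ℝ φ x (stdVec i) ∂(vol Ω) := fun f =>
      integral_congr_ae (Eventually.of_forall fun x => mul_comm _ _)
    simp_rw [e3] at l1
    simp_rw [(hgrad _).2 φ i] at l1
    exact tendsto_nhds_unique l1 l2.neg
  have hyW : MemW11 Ω y₀ := ⟨hy₀.integrable (by norm_num), v₀, hwg⟩
  have hveq : v₀ =ᵐ[vol Ω] weakGradient Ω y₀ := hwg.ae_eq hyW.isWeakGradient
  -- `y₀` belongs to the closure of the test functions
  have hlimD : IsGradientLimit Ω ΓD y₀ v₀ := by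
    have hquot : ∀ {s : Eu N → ℝ}, (∀ᵐ x ∂(vol Ω), ξ₁ x ≤ s x ∧ s x ≤ ξ₂ x) →
        ∀ᵐ x ∂(vol Ω), ‖√(ξ₁ x) * (√(s x))⁻¹‖ ≤ 1 := by
      intro s hs
      filter_upwards [hs, hξ₁pos] with x h1 h2
      rw [Real.norm_of_nonneg (by positivity), ← div_eq_mul_inv]
      exact div_le_one_of_le₀ (Real.sqrt_le_sqrt h1.1) (Real.sqrt_nonneg _)
    have hb1 : AEStronglyMeasurable (fun x => √(ξ₁ x)) (vol Ω) :=
      Real.continuous_sqrt.comp_aestronglyMeasurable hξ₁m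
    have hle : ∀ {c : ℝ} (a : Eu N), ‖c‖ ≤ 1 → ‖c • a‖ ≤ ‖a‖ := fun {c} a hc => by
      rw [norm_smul]; exact mul_le_of_le_one_left (norm_nonneg _) hc
    have hbu : ∀ k, (fun x => √(ξ₁ x) • v k x) =ᵐ[vol Ω]
        fun x => (√(ξ₁ x) * (√(r k x))⁻¹) • u k x := by
      intro k
      filter_upwards [hpos k] with x hx
      have h0 : √(r k x) ≠ 0 := (Real.sqrt_pos.2 hx).ne'
      simp only [u]
      rw [smul_smul, mul_assoc, inv_mul_cancel₀ h0, mul_one]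
    -- The rescaling `√ξ₁` does not depend on `k`, so all pairs lie in one closed subspace. The
    -- ratios `√ξ₁ / √(r k)` are at most `1`, so `√ξ₁ v k` stays in `L²`.
    refine IsGradientLimit.of_weak (b := fun x => √(ξ₁ x)) (v := v) (v₀ := v₀)
      (hξ₁pos.mono fun x hx => Real.sqrt_pos.2 hx) hinv₁ hy hy₀ (fun k => ?_) ?_ hyw
      (fun g hg => ?_) fun k => (hyD k).2
    · refine (memLp_congr_ae (hbu k)).2 ((hu k).mono
        ((hb1.mul (hinvm (hr k))).smul (hu k).1) ?_)
      filter_upwards [hquot (hrξ k)] with x hx using hle _ hx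
    · refine hu₀.mono (hb1.smul hv₀i.1) ?_
      filter_upwards [hquot hr₀ξ] with x hx
      simp only [v₀]
      rw [smul_smul]
      exact hle _ hx
    · have l := pair (g := fun k x => (√(ξ₁ x) * (√(r k x))⁻¹) • g x)
        (g₀ := fun x => (√(ξ₁ x) * (√(r₀ x))⁻¹) • g x) hg.norm
        (fun k => (hb1.mul (hinvm (hr k))).smul hg.1)
        (fun k => by filter_upwards [hquot (hrξ k)] with x hx using hle _ hx)
        (by
          filter_upwards [hinvlim] with x hx
          exact (hx.const_mul _).smul_const _)
      have e2 : ∫ x, inner ℝ (√(ξ₁ x) • v₀ x) (g x) ∂(vol Ω)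
          = ∫ x, inner ℝ (u₀ x) ((√(ξ₁ x) * (√(r₀ x))⁻¹) • g x) ∂(vol Ω) := by
        refine integral_congr_ae (Eventually.of_forall fun x => ?_)
        simp only [v₀]
        rw [smul_smul, real_inner_smul_left, real_inner_smul_right]
      rw [e2]
      refine l.congr fun k => integral_congr_ae ?_
      filter_upwards [hbu k] with x hx
      rw [hx, real_inner_smul_left (u k x), real_inner_smul_right (u k x)]
  have hmem : MemLp (weakGradient Ω y₀) 2 (weightedMeasure Ω r₀) := by
    have hac : weightedMeasure Ω r₀ ≪ vol Ω := withDensity_absolutelyContinuous _ _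
    refine ⟨hyW.isWeakGradient.1.1.mono_ac hac, ?_⟩
    rw [← eLpNorm_sqrt_smul hr₀.1.aemeasurable hyW.isWeakGradient.1.1]
    refine lt_of_eq_of_lt (eLpNorm_congr_ae ?_) hu₀.2
    filter_upwards [hveq, huv₀] with x h1 h2
    rw [← h1, h2]
  refine ⟨⟨⟨hyW, hlimD.congr_ae EventuallyEq.rfl hveq⟩, hy₀, hmem⟩, fun φ => ?_⟩
  obtain ⟨M, hM⟩ := hφb φ
  have h_int : ∀ {s : Eu N → ℝ} {a : Eu N → Eu N}, Integrable s (vol Ω) →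
      (∀ᵐ x ∂(vol Ω), 0 < s x) → MemLp (fun x => √(s x) • a x) 2 (vol Ω) →
      Integrable (fun x => s x • φ x • a x) (vol Ω) := by
    intro s a hs hs0 hsa
    have h1 : Integrable (fun x => √(s x) • √(s x) • a x) (vol Ω) := by
      rw [← memLp_one_iff_integrable]
      exact hsa.smul (memLp_two_sqrt hs)
    have h2 : Integrable (fun x => φ x • √(s x) • √(s x) • a x) (vol Ω) :=
      h1.bdd_smul M φ.continuous.aestronglyMeasurable (Eventually.of_forall hM)
    refine h2.congr ?_
    filter_upwards [hs0] with x hx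
    rw [smul_smul (√(s x)), Real.mul_self_sqrt hx.le, smul_comm]
  simp_rw [integral_weightedMeasure (hr _).1.aemeasurable (hpos _)]
  rw [integral_weightedMeasure hr₀.1.aemeasurable hpos₀]
  have hcoord : ∀ i : Fin N, Tendsto
      (fun k => (∫ x, r k x • φ x • v k x ∂(vol Ω)) i) atTop
      (𝓝 ((∫ x, r₀ x • φ x • weakGradient Ω y₀ x ∂(vol Ω)) i)) := by
    intro i
    -- As `r k * v k = √(r k) * u k`, the weighted integral is the pairing of `u k` with `√(r k) φ
    -- e_i`, dominated through `√ξ₂`.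
    have l := pair (g := fun k x => (√(r k x) * φ x) • stdVec i)
      (g₀ := fun x => (√(r₀ x) * φ x) • stdVec i) ((memLp_two_sqrt hξ₂).mul_const M)
      (fun k => ((hsm k).1.mul φ.continuous.aestronglyMeasurable).smul_const _)
      (fun k => by
        filter_upwards [hrξ k] with x hx
        rw [norm_smul, norm_mul]
        simp only [stdVec, PiLp.norm_single, norm_one, mul_one]
        rw [Real.norm_of_nonneg (Real.sqrt_nonneg _)]
        exact mul_le_mul (Real.sqrt_le_sqrt hx.2) (hM x) (norm_nonneg _) (Real.sqrt_nonneg _))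
      (by
        filter_upwards [hsqlim] with x hx
        exact (hx.mul_const _).smul_const _)
    have hproj : ∀ {F : Eu N → Eu N}, Integrable F (vol Ω) →
        (∫ x, F x ∂(vol Ω)) i = ∫ x, F x i ∂(vol Ω) := fun hF =>
      ((EuclideanSpace.proj (𝕜 := ℝ) i).integral_comp_comm hF).symm
    rw [hproj (h_int hr₀ hpos₀ ((memLp_congr_ae (by
      filter_upwards [hveq, huv₀] with x h1 h2
      rw [← h1, h2])).2 hu₀))]
    have e2 : ∫ x, inner ℝ (u₀ x) ((√(r₀ x) * φ x) • stdVec i) ∂(vol Ω)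
        = ∫ x, (r₀ x • φ x • weakGradient Ω y₀ x) i ∂(vol Ω) := by
      refine integral_congr_ae ?_
      filter_upwards [hveq, huv₀, hpos₀] with x h1 h2 h3
      rw [← h1, ← h2]
      simp only [stdVec, inner_smul_left, inner_smul_right, EuclideanSpace.inner_single_right]
      simp
      nth_rewrite 3 [← Real.mul_self_sqrt h3.le]
      ring
    rw [e2] at l
    refine l.congr fun k => ?_
    rw [hproj (h_int (hr k) (hpos k) (hu k))]
    refine integral_congr_ae ?_
    filter_upwards [hpos k] with x h3
    simp only [u, stdVec, inner_smul_left, inner_smul_right, EuclideanSpace.inner_single_right]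
    simp
    nth_rewrite 3 [← Real.mul_self_sqrt h3.le]
    ring
  exact ((PiLp.continuous_toLp 2 _).tendsto _).comp (tendsto_pi_nhds.2 hcoord)

end WeightedControl

/-! ### Extraction of the subsequence and assembly -/

theorem lemma3p1 (N : ℕ) (hN : 1 ≤ N)
    (Ω : TopologicalSpace.Opens (EuclideanSpace ℝ (Fin N)))
    (hΩb : Bornology.IsBounded (Ω : Set (EuclideanSpace ℝ (Fin N))))
    (hΩL : WeightedControl.HasLipschitzBoundary Ω)
    (ΓD ΓN : Set (EuclideanSpace ℝ (Fin N)))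
    (hΓ : ΓD ∪ ΓN = frontier (Ω : Set (EuclideanSpace ℝ (Fin N))))
    (hΓdisj : Disjoint ΓD ΓN)
    (ξ₁ ξ₂ : EuclideanSpace ℝ (Fin N) → ℝ)
    (hξ₁ : MeasureTheory.Integrable ξ₁ (WeightedControl.vol Ω))
    (hξ₂ : MeasureTheory.Integrable ξ₂ (WeightedControl.vol Ω))
    (hξ₁pos : ∀ᵐ x ∂(WeightedControl.vol Ω), 0 < ξ₁ x)
    (hξ : ∀ᵐ x ∂(WeightedControl.vol Ω), ξ₁ x ≤ ξ₂ x)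
    (hξ₁inv : MeasureTheory.Integrable (fun x => (ξ₁ x)⁻¹) (WeightedControl.vol Ω))
    (m : ℝ) (hm : 0 < m)
    (f : EuclideanSpace ℝ (Fin N) → ℝ) (hf : MeasureTheory.MemLp f 2 (WeightedControl.vol Ω))
    (p : ℕ → (EuclideanSpace ℝ (Fin N) → ℝ) × (EuclideanSpace ℝ (Fin N) → ℝ))
    (hp : ∀ k, p k ∈ WeightedControl.XiW Ω ΓD ξ₁ ξ₂ m f)
    (hbdd : WeightedControl.BoundedPairs Ω p) :
    ∃ ρ y : EuclideanSpace ℝ (Fin N) → ℝ,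
      WeightedControl.MemBV Ω ρ ∧ WeightedControl.MemW11 Ω y ∧
      (∃ σ : ℕ → ℕ, StrictMono σ ∧ WeightedControl.TauConv Ω (fun k => p (σ k)) ρ y) ∧
      WeightedControl.IsWeight Ω ρ ∧ WeightedControl.MemWρ Ω ΓD ρ y := by
  open WeightedControl in
  set B : ℝ≥0∞ := ⨆ k, (bvNorm Ω (p k).1 + eLpNorm (p k).2 2 (vol Ω)
    + eLpNorm (weakGradient Ω (p k).2) 2 (weightedMeasure Ω (p k).1))
  have hB : B ≠ ⊤ := ne_of_lt hbdd
  have hBk : ∀ k, bvNorm Ω (p k).1 + eLpNorm (p k).2 2 (vol Ω)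
      + eLpNorm (weakGradient Ω (p k).2) 2 (weightedMeasure Ω (p k).1) ≤ B := fun k =>
    le_iSup (fun k => bvNorm Ω (p k).1 + eLpNorm (p k).2 2 (vol Ω)
      + eLpNorm (weakGradient Ω (p k).2) 2 (weightedMeasure Ω (p k).1)) k
  have hTV : ∀ k, totalVariation Ω (p k).1 ≤ ENNReal.ofReal B.toReal := fun k => by
    rw [ENNReal.ofReal_toReal hB]
    exact le_trans (le_add_self.trans (le_self_add.trans le_self_add)) (hBk k)
  have hyB : ∀ k, eLpNorm (p k).2 2 (vol Ω) ≤ B := fun k =>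
    le_trans (le_add_self.trans le_self_add) (hBk k)
  have hvB : ∀ k, eLpNorm (weakGradient Ω (p k).2) 2 (weightedMeasure Ω (p k).1) ≤ B := fun k =>
    le_trans le_add_self (hBk k)
  have hC : 0 ≤ B.toReal := ENNReal.toReal_nonneg
  have hadm : ∀ k, Admissible Ω ξ₁ ξ₂ m (p k).1 := fun k => (hp k).1
  have hW : ∀ k, MemWρ Ω ΓD (p k).1 (p k).2 := fun k => (hp k).2.1
  have h_int : ∀ k, Integrable (p k).1 (vol Ω) := fun k => (hadm k).1.2.1
  have hbd : ∀ k, ∀ᵐ x ∂(vol Ω), ξ₁ x ≤ (p k).1 x ∧ (p k).1 x ≤ ξ₂ x := fun k => (hadm k).2.2.2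
  obtain ⟨ρ, σ₁, hσ₁, hρ, hρTV, hL1, hae⟩ := exists_subseq_tendsto_of_variation hΩb hξ₂
    (by filter_upwards [hξ₁pos, hξ] with x h1 h2 using h1.trans_le h2) h_int
    (fun k => (hadm k).1.1.mono fun x hx => hx.le) (fun k => (hbd k).mono fun x hx => hx.2) hC hTV
  obtain ⟨y, σ₂, hσ₂, hy, hyw⟩ := exists_subseq_tendsto_integral_inner
    (fun k => (hW (σ₁ k)).2.1) hB (fun k => hyB (σ₁ k))
  have hvm : ∀ k, AEStronglyMeasurable (weakGradient Ω (p k).2) (vol Ω) := fun k =>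
    (hW k).1.1.isWeakGradient.1.1
  have huB : ∀ k, eLpNorm (fun x => √((p k).1 x) • weakGradient Ω (p k).2 x) 2 (vol Ω) ≤ B :=
    fun k => (eLpNorm_sqrt_smul (h_int k).1.aemeasurable (hvm k)).trans_le (hvB k)
  have hu : ∀ k, MemLp (fun x => √((p k).1 x) • weakGradient Ω (p k).2 x) 2 (vol Ω) := fun k =>
    ⟨(memLp_two_sqrt (h_int k)).1.smul (hvm k), (huB k).trans_lt hB.lt_top⟩
  obtain ⟨u, σ₃, hσ₃, hu₀, huw⟩ := exists_subseq_tendsto_integral_inner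
    (fun k => hu (σ₁ (σ₂ k))) hB (fun k => huB (σ₁ (σ₂ k)))
  have hσ : StrictMono fun k => σ₁ (σ₂ (σ₃ k)) := hσ₁.comp (hσ₂.comp hσ₃)
  have hτ : Tendsto (fun k => σ₂ (σ₃ k)) atTop atTop := (hσ₂.comp hσ₃).tendsto_atTop
  have hae' : ∀ᵐ x ∂(vol Ω), Tendsto (fun k => (p (σ₁ (σ₂ (σ₃ k)))).1 x) atTop (𝓝 (ρ x)) :=
    hae.mono fun x hx => hx.comp hτ
  -- The pointwise bounds survive the a.e. limit; they make `ρ` positive with `1 / ρ ≤ 1 / ξ₁`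
  -- integrable.
  have hρbd : ∀ᵐ x ∂(vol Ω), ξ₁ x ≤ ρ x ∧ ρ x ≤ ξ₂ x := by
    filter_upwards [hae, ae_all_iff.2 hbd] with x hx hx2
    exact ⟨ge_of_tendsto hx (Eventually.of_forall fun k => (hx2 _).1),
      le_of_tendsto hx (Eventually.of_forall fun k => (hx2 _).2)⟩
  have hyw' : ∀ g, MemLp g 2 (vol Ω) → Tendsto
      (fun k => ∫ x, inner ℝ ((p (σ₁ (σ₂ (σ₃ k)))).2 x) (g x) ∂(vol Ω)) atTop
      (𝓝 (∫ x, inner ℝ (y x) (g x) ∂(vol Ω))) := fun g hg =>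
    (hyw g hg).comp hσ₃.tendsto_atTop
  obtain ⟨hyW, hvar⟩ := tendsto_weighted_gradients hΩb hξ₂ hξ₁.1 hξ₁pos hξ₁inv
    (r := fun k => (p (σ₁ (σ₂ (σ₃ k)))).1) (y := fun k => (p (σ₁ (σ₂ (σ₃ k)))).2)
    (fun k => h_int _) hρ (fun k => hbd _) hρbd hae' (fun k => (hW _).2.1) hy
    (fun k => (hW _).1) hyw' hB (fun k => hvB _) hu₀ huw
  have hBV : MemBV Ω ρ := ⟨hρ, hρTV.trans_lt ENNReal.ofReal_lt_top⟩
  have hweight : IsWeight Ω ρ := by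
    refine ⟨by filter_upwards [hξ₁pos, hρbd] with x h1 h2 using h1.trans_le h2.1, hρ, ?_⟩
    refine hξ₁inv.mono' hρ.1.aemeasurable.inv.aestronglyMeasurable ?_
    filter_upwards [hξ₁pos, hρbd] with x h1 h2
    rw [Real.norm_of_nonneg (inv_nonneg.2 (h1.trans_le h2.1).le)]
    exact inv_anti₀ h1 h2.1
  refine ⟨ρ, y, hBV, hyW.1.1, ⟨fun k => σ₁ (σ₂ (σ₃ k)), hσ, ?_, hBV, hyW.1.1, ?_, ?_, ?_⟩,
    hweight, hyW⟩
  · exact (iSup_le fun k => hBk _).trans_lt hbdd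
  · exact bvWeakConv_of_tendsto (fun k => h_int _) hρ hC (fun k => hTV _) hρTV (hL1.comp hτ)
  · refine ⟨fun k => (hW _).2.1, hy, fun g hg => ?_⟩
    have e : ∀ a : Eu N → ℝ, ∫ x, inner ℝ (a x) (g x) ∂(vol Ω) = ∫ x, a x * g x ∂(vol Ω) :=
      fun a => integral_congr_ae (Eventually.of_forall fun x => mul_comm _ _)
    simpa only [e] using hyw' g hg
  · refine ⟨⟨fun k => (hW _).2.2, ?_⟩, hyW.2.2, hvar⟩
    refine lt_of_le_of_lt (limsup_le_iSup.trans (iSup_le fun k => ?_))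
      (ENNReal.pow_lt_top hB.lt_top : B ^ 2 < ⊤)
    rw [lintegral_enorm_sq_eq_eLpNorm_sq]
    gcongr
    exact hvB _
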